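/- **Setting.** Let $m\ge 1$, $f,g_1,\dots,g_m:\mathbb R^n\to\mathbb R$, $g=\max_i g_i$, and consider $\min f(x)$ subject to $g(x)\le 0$. Let $F=\{x: g(x)\le 0\}$, let $p_\star=\inf_F f$ be finite, let $x_0\in F$, and suppose that for some $\Delta>0$ and $M>0$ the functions $f,g_1,\dots,g_m$ are $M$-Lipschitz on $N=\{x:\mathrm{dist}(x,F)<\Delta\}$. Put $h_x(z)=\max\{f(z)-f(x),g(z)\}$. For a notion of subdifferential $\partial$ let $\partial_\delta h(x)=\mathrm{conv}\bigcup_{y\in B(x,\delta)}\partial h(y)$, with $B(x,\delta)$ the closed ball. A point $x\in F$ is $(\delta,\epsilon,\eta)$-Goldstein KKT if for some $\lambda\ge0$, $\mathrm{dist}(0,\partial_\delta f(x)+\lambda\,\partial_\delta g(x))\le\epsilon$ and $|\lambda g(y)|\le\eta$ for all $y\in B(x,\delta)$. The $(a,b,c)$-Goldstein constraint qualification (GCQ) holds at $x\in F$ if $g(x)\ge -c$ implies $\mathrm{dist}(0,\partial_a g(x))\ge b$. **Method.** Given $\delta\in(0,\Delta)$, $\tilde\epsilon>0$: for $k=0,1,\dots$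 a subroutine is called at $x_k$ and outputs a vector $\zeta_k$; if $\|\zeta_k\|\le\tilde\epsilon$, return $x_k$; otherwise $x_{k+1}=x_k-\delta\zeta_k/\|\zeta_k\|$. **Theorem.** Let $\epsilon,\sigma>0$, $0<\delta<\Delta$, suppose $(\delta,\sigma,2M\delta)$-GCQ holds at every $x\in F$, and set $\tilde\epsilon=\sigma\epsilon/(\epsilon+\sigma+M)$, $\eta=3M\delta(\epsilon+\sigma+M)/\sigma$. 1. (Black-box subroutine, any fixed notion $\partial$.) Let $\mathcal G_f(z)\in\partial f(z)$, $\mathcal G_g(z)\in\partial g(z)$, $\|\mathcal G_f(z)\|\le M$ for $z\in N$, and let $\mathcal G_{h_x}(z)$ equal $\mathcal G_f(z)$ if $f(z)-f(x)>g(z)$, $\mathcal G_g(z)$ if $f(z)-f(x)<g(z)$, and one of the two in case of equality. Let $C\in(0,1)$ and let every output $\zeta$ of the subroutine at $x$ be a finite convex combination of vectors $\mathcal G_{h_x}(z_i)$, $z_i\in B(x,\delta)$, with $\|\zeta\|\le\tilde\epsilon$ or $h_x(x)-h_x(x-\delta\zeta/\|\zeta\|)\ge C\delta\tilde\epsilon$.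 Then the method terminates and returns a $(\delta,\epsilon,\eta)$-Goldstein KKT point. 2. (Randomized subroutine, $\partial$ = Clarke subdifferential.) Let (measurable) oracles return $\nabla f$ and $\nabla g$ almost everywhere on $N$; as oracle for $h_x$ use $\nabla f(z)$ if $f(z)-f(x)\ge g(z)$ and $\nabla g(z)$ otherwise. At $x$ the subroutine starts with $\zeta=\nabla h_x(y_0)$, $y_0$ uniform on $B(x,\delta)$; while $\|\zeta\|>\tilde\epsilon$ and $\delta\|\zeta\|/4\ge h_x(x)-h_x(x-\delta\zeta/\|\zeta\|)$ it chooses any $0<r<\|\zeta\|\sqrt{1-(1-\|\zeta\|^2/128M^2)^2}$, samples $y$ uniformly from $B(\zeta,r)$ and $s$ uniformly from $[x,x-\delta y/\|y\|]$, and replaces $\zeta$ by the minimal norm point of $[\zeta,\nabla h_x(s)]$; it outputs the final $\zeta$. Then almost surely the method terminates at a $(\delta,\epsilon,\eta)$-Goldstein KKT point, and for every $\tau\in(0,1)$, with probability at least $1-\tau$, this takes, with $A=\max\{1,4(f(x_0)-p_\star)/(\delta\tilde\epsilon)\}$, at most $$\lceil A\rceil\Big\lceil\frac{64M^2}{\tilde\epsilon^2}\Big\rceil\Big\lceil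 2\log\frac A\tau\Big\rceil$$ gradient oracle calls. 3. (Deterministic subroutine, any $\partial$ containing the oracle values.) Let $f,g$ be directionally differentiable with oracles $F(x,v)\in\partial f(x)$, $G(x,v)\in\partial g(x)$ of norm at most $M$ for $x\in N$, with $\langle F(x,v),v\rangle=\nabla_vf(x)$ and $\langle G(x,v),v\rangle=\nabla_vg(x)$ everywhere, and let $\Lambda_f(\delta),\Lambda_g(\delta)<\infty$. Here $\Lambda_h(\delta)$ is the supremum over $\|x-y\|\le\delta$ of the infimum of all $K\ge0$ for which some convex $K$-Lipschitz $s:[0,\delta]\to\mathbb R$ makes $r\mapsto h(x+r(y-x)/\delta)+s(r)$ convex on $[0,\delta]$. Let $H_x(z,v)$ be $F(z,v)$ if $f(z)-f(x)>g(z)$, or if $f(z)-f(x)=g(z)$ and $\nabla_vf(z)\ge\nabla_vg(z)$, and $G(z,v)$ otherwise. At $x$ the subroutine starts with $\zeta=H_x(x,v_0)$ for any direction $v_0$; while $\|\zeta\|>\tilde\epsilon$ and $\delta\tilde\epsilon/3>h_x(x)-h_x(x-\delta\hat\zeta)$, where $\hat\zeta=\zeta/\|\zeta\|$, it finds by bisection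 an $r\in[0,\delta]$ such that $w=H_x(x+(r-\delta)\hat\zeta,\hat\zeta)$ has $\langle w,\hat\zeta\rangle<\tilde\epsilon/2$ and replaces $\zeta$ by the minimal norm point of $[\zeta,w]$; it outputs the final $\zeta$. The bisection starts with $[0,\delta]$, tests the left end point of the current interval (once per end point), and if the test fails keeps the half on which $r\mapsto h_x(x+(r-\delta)\hat\zeta)-\tilde\epsilon r/2$ decreases more (the right half in case of a tie). Then the method terminates at a $(\delta,\epsilon,\eta)$-Goldstein KKT point after at most $$\Big\lceil\max\Big\{1,\frac{3(f(x_0)-p_\star)}{\delta\tilde\epsilon}\Big\}\Big\rceil\Big\lceil\frac{16M^2}{\tilde\epsilon^2}\Big\rceil\Big(1+\Big\lfloor\frac{12(\Lambda_f(\delta)+\Lambda_g(\delta))}{\tilde\epsilon}\Big\rfloor\Big)$$ evaluations of the subgradient oracle $H$. -/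

import Mathlib

open MeasureTheory ProbabilityTheory Filter Topology Set
open scoped Pointwise NNReal ENNReal InnerProductSpace

noncomputable section

namespace Goldstein

/-- The Euclidean space `ℝⁿ`. -/
abbrev E (n : ℕ) := EuclideanSpace ℝ (Fin n)

variable {n : ℕ}

/-! ### Problem data -/

/-- The combined constraint `g(x) = max_{i=1,…,m} gᵢ(x)` (used only for `m ≥ 1`). -/
def maxConstraint {m : ℕ} (gs : Fin m → E n → ℝ) (x : E n) : ℝ := ⨆ i, gs i x

/-- The feasible region `{x | g(x) ≤ 0}`. -/
def feasible (g : E n → ℝ) : Set (E n) := {x | g x ≤ 0}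

/-- The auxiliary function `h_x(z) = max {f(z) - f(x), g(z)}`. -/
def hFun (f g : E n → ℝ) (x z : E n) : ℝ := max (f z - f x) (g z)

/-! ### Subdifferentials and Goldstein stationarity -/

/-- A notion of subdifferential: to every function `h` and point `x`, a set `∂h(x)`. -/
abbrev Subdiff (n : ℕ) := (E n → ℝ) → E n → Set (E n)

/-- The Clarke subdifferential: the convex hull of all limits of gradients at points of
differentiability converging to `x`. -/
def clarke : Subdiff n := fun h x =>
  convexHull ℝ {v | ∃ u : ℕ → E n, (∀ i, DifferentiableAt ℝ h (u i)) ∧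
    Tendsto u atTop (𝓝 x) ∧ Tendsto (fun i => gradient h (u i)) atTop (𝓝 v)}

/-- The Goldstein subdifferential `∂_δ h(x) = conv (⋃_{y ∈ B(x,δ)} ∂h(y))`. -/
def goldstein (D : Subdiff n) (h : E n → ℝ) (δ : ℝ) (x : E n) : Set (E n) :=
  convexHull ℝ (⋃ y ∈ Metric.closedBall x δ, D h y)

/-- `(δ, ε, η)`-Goldstein KKT stationarity of `x` for `min f` subject to `gᵢ ≤ 0`, `i ∈ ι`.
The distance to a set is the extended one (infinite for the empty set). -/
def IsGKKT {ι : Type*} [Fintype ι] (D : Subdiff n) (f : E n → ℝ) (g : ι → E n → ℝ)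
    (δ ε η : ℝ) (x : E n) : Prop :=
  (∀ i, g i x ≤ 0) ∧ ∃ l : ι → ℝ, (∀ i, 0 ≤ l i) ∧
    Metric.infEDist 0 (goldstein D f δ x + ∑ i, l i • goldstein D (g i) δ x)
      ≤ ENNReal.ofReal ε ∧
    ∀ i, ∀ y ∈ Metric.closedBall x δ, |l i * g i y| ≤ η

/-- `(a, b, c)`-Goldstein constraint qualification at `x`. -/
def GCQ {ι : Type*} [Fintype ι] (D : Subdiff n) (g : ι → E n → ℝ)
    (a b c : ℝ) (x : E n) : Prop :=
  ∀ γ : ι → ℝ, (∀ i, 0 ≤ γ i) → ∑ i, γ i = 1 → (∀ i, g i x < -c → γ i = 0) →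
    ENNReal.ofReal b ≤ Metric.infEDist 0 (∑ i, γ i • goldstein D (g i) a x)

/-! ### The outer method with a black-box subroutine -/

/-- The step `x - δ ζ / ‖ζ‖`. -/
def move (δ : ℝ) (x ζ : E n) : E n := x - (δ / ‖ζ‖) • ζ

/-- General requirement on subgradient-type oracles `Gf, Gg, Gh` for `f`, `g`, `h_x` on the
neighbourhood `N` of the feasible region. Oracle vectors of the `M`-Lipschitz objective have
norm at most `M`. (Membership of `Gh x z` in a subdifferential of `h_x` is not required.) -/
structure IsOracle (D : Subdiff n) (f g : E n → ℝ) (N : Set (E n)) (M : ℝ)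
    (Gf Gg : E n → E n) (Gh : E n → E n → E n) : Prop where
  mem_f : ∀ z ∈ N, Gf z ∈ D f z
  mem_g : ∀ z ∈ N, Gg z ∈ D g z
  norm_f : ∀ z ∈ N, ‖Gf z‖ ≤ M
  of_gt : ∀ x ∈ feasible g, ∀ z ∈ N, g z < f z - f x → Gh x z = Gf z
  of_eq : ∀ x ∈ feasible g, ∀ z ∈ N, f z - f x = g z → Gh x z = Gf z ∨ Gh x z = Gg z
  of_lt : ∀ x ∈ feasible g, ∀ z ∈ N, f z - f x < g z → Gh x z = Gg z

/-- `ζ` is an admissible output of the black-box subroutine for the function `h` with oracle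
`Gh` at `x`: a finite convex combination of oracle vectors from the ball `B(x,δ)` such that
`‖ζ‖ ≤ ε` or `h(x) - h(x - δζ/‖ζ‖) ≥ Cδε`. -/
def IsSubroutineOutput (h : E n → ℝ) (Gh : E n → E n) (C δ ε : ℝ) (x ζ : E n) : Prop :=
  (∃ (t : ℕ) (z : Fin t → E n) (w : Fin t → ℝ), (∀ i, z i ∈ Metric.closedBall x δ) ∧
    (∀ i, 0 ≤ w i) ∧ ∑ i, w i = 1 ∧ ζ = ∑ i, w i • Gh (z i)) ∧
  (‖ζ‖ ≤ ε ∨ C * δ * ε ≤ h x - h (move δ x ζ))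

/-- `(x k, ζ k)` is a run of the constrained Goldstein subgradient method from `x₀`: as long as
the method has not stopped (it stops at the first `k` with `‖ζ k‖ ≤ ε`, returning `x k`),
`ζ k` is an admissible output of the subroutine at `x k`, and `x (k+1) = x k - δ ζ k / ‖ζ k‖`.
The values of `x` and `ζ` after the method has stopped are irrelevant. -/
structure IsRun (f g : E n → ℝ) (Gh : E n → E n → E n) (C δ ε : ℝ) (x₀ : E n)
    (x ζ : ℕ → E n) : Prop where
  init : x 0 = x₀
  output : ∀ k, (∀ j < k, ε < ‖ζ j‖) →
    IsSubroutineOutput (hFun f g (x k)) (Gh (x k)) C δ ε (x k) (ζ k)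
  next : ∀ k, (∀ j ≤ k, ε < ‖ζ j‖) → x (k + 1) = move δ (x k) (ζ k)

/-! ### The minimum norm point of a segment -/

/-- The point of minimal norm of the segment `[a, b]`. -/
def minNormSeg (a b : E n) : E n :=
  AffineMap.lineMap a b (max 0 (min 1 (⟪a, a - b⟫_ℝ / ‖a - b‖ ^ 2)))

theorem minNormSeg_mem (a b : E n) : minNormSeg a b ∈ segment ℝ a b := by
  rw [segment_eq_image_lineMap]
  exact ⟨_, ⟨le_max_left _ _, max_le zero_le_one (min_le_left _ _)⟩, rfl⟩

theorem norm_minNormSeg_le (a b w : E n) (hw : w ∈ segment ℝ a b) :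
    ‖minNormSeg a b‖ ≤ ‖w‖ := by
  rw [segment_eq_image_lineMap] at hw
  obtain ⟨s, ⟨hs0, hs1⟩, rfl⟩ := hw
  have key : ∀ t : ℝ, ‖AffineMap.lineMap a b t‖ ^ 2 =
      ‖a‖ ^ 2 - 2 * t * ⟪a, a - b⟫_ℝ + t ^ 2 * ‖a - b‖ ^ 2 := by
    intro t
    have : (AffineMap.lineMap a b t : E n) = a - t • (a - b) := by
      rw [AffineMap.lineMap_apply_module]; module
    rw [this, norm_sub_sq_real, inner_smul_right, norm_smul, mul_pow, Real.norm_eq_abs, sq_abs]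
    ring
  refine (sq_le_sq₀ (norm_nonneg _) (norm_nonneg _)).mp ?_
  unfold minNormSeg
  rw [key, key]
  rcases eq_or_ne (‖a - b‖) 0 with h0 | h0
  · have : a - b = 0 := norm_eq_zero.mp h0
    simp [this]
  have hp : 0 < ‖a - b‖ ^ 2 := by positivity
  set q := ‖a - b‖ ^ 2
  obtain ⟨c, hc⟩ : ∃ c, c = ⟪a, a - b⟫_ℝ / q := ⟨_, rfl⟩
  have hcq : ⟪a, a - b⟫_ℝ = c * q := by rw [hc]; field_simp
  rw [← hc, hcq]
  have : ∀ t : ℝ, ‖a‖ ^ 2 - 2 * t * (c * q) + t ^ 2 * q = ‖a‖ ^ 2 - c ^ 2 * q + (t - c) ^ 2 * q := by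
    intro t; ring
  rw [this, this]
  have h2 : (max 0 (min 1 c) - c) ^ 2 ≤ (s - c) ^ 2 := by
    rcases le_total c 0 with h | h
    · rw [min_eq_right (by linarith), max_eq_left h]; nlinarith
    · rcases le_total c 1 with h' | h'
      · rw [min_eq_right h', max_eq_right h]; nlinarith [sq_nonneg (s - c)]
      · rw [min_eq_left h', max_eq_right zero_le_one]; nlinarith
  nlinarith

/-! ### The randomized subroutine inside the outer method

The whole method is run as a state machine in which every step out of a state that is not
`done` makes exactly one gradient oracle call, so that the number of steps until `done`
is the number of oracle calls. -/

/-- The gradient oracle for `h_x` built from gradient oracles for `f` and `g`. -/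
def gradOracle (f g : E n → ℝ) (Gf Gg : E n → E n) (x z : E n) : E n :=
  if g z ≤ f z - f x then Gf z else Gg z

/-- States of the method with the randomized subroutine. -/
inductive RState (n : ℕ) where
  /-- the subroutine is about to be started at the outer iterate `x` -/
  | call (x : E n)
  /-- inside the `while` loop at outer iterate `x`, with current inner vector `ζ` -/
  | inner (x ζ : E n)
  /-- the method has returned `x` -/
  | done (x : E n)

/-- What happens once the inner vector `ζ` has been computed: if the `while` condition holds,
the subroutine enters the loop body; otherwise it outputs `ζ`, and the outer method
returns `x` (if `‖ζ‖ ≤ ε`) or moves to `x - δζ/‖ζ‖`. -/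
def RState.settle (f g : E n → ℝ) (δ ε : ℝ) (x ζ : E n) : RState n :=
  if ε < ‖ζ‖ ∧ hFun f g x x - hFun f g x (move δ x ζ) ≤ δ * ‖ζ‖ / 4 then .inner x ζ
  else if ‖ζ‖ ≤ ε then .done x
  else .call (move δ x ζ)

/-- One step, with radius `r`, and with random inputs `u` (uniform in the unit ball) and
`v` (uniform in `[0,1]`). The initial sample is `x + δ u ∈ B(x,δ)`; in the loop body
`y = ζ + r u ∈ B(ζ,r)` and `s = x - v δ y/‖y‖ ∈ [x, x - δ y/‖y‖]`. -/
def RState.step (f g : E n → ℝ) (Gf Gg : E n → E n) (δ ε r : ℝ) (u : E n) (v : ℝ) :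
    RState n → RState n
  | .call x => RState.settle f g δ ε x (gradOracle f g Gf Gg x (x + δ • u))
  | .inner x ζ =>
      RState.settle f g δ ε x
        (minNormSeg ζ (gradOracle f g Gf Gg x (move (v * δ) x (ζ + r • u))))
  | .done x => .done x

/-- The state after `j` oracle calls. -/
def randState (f g : E n → ℝ) (Gf Gg : E n → E n) (δ ε : ℝ) (x₀ : E n)
    (r : ℕ → ℝ) (u : ℕ → E n) (v : ℕ → ℝ) : ℕ → RState n
  | 0 => .call x₀
  | j + 1 => RState.step f g Gf Gg δ ε (r j) (u j) (v j)
      (randState f g Gf Gg δ ε x₀ r u v j)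

/-- A fresh source of randomness at each oracle call: `(U j, V j)` is uniform on
(unit ball) × `[0,1]`, independent of the past `ℱ j`, and known at time `j + 1`. -/
structure IsRandomSource {Ω : Type*} [MeasurableSpace Ω] (μ : Measure Ω)
    (ℱ : Filtration ℕ (inferInstance : MeasurableSpace Ω))
    (U : ℕ → Ω → E n) (V : ℕ → Ω → ℝ) : Prop where
  adapted : ∀ j, Measurable[ℱ (j + 1)] (fun ω => (U j ω, V j ω))
  uniform : ∀ j, pdf.IsUniform (fun ω => (U j ω, V j ω))
    (Metric.closedBall (0 : E n) 1 ×ˢ Icc (0 : ℝ) 1) μ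
  indep : ∀ j, Indep (MeasurableSpace.comap (fun ω => (U j ω, V j ω)) inferInstance) (ℱ j) μ

/-- The radii `r` are an admissible choice: `r j` is chosen from the past `ℱ j`, and almost
surely, whenever call `j` is made in the loop body with inner vector `ζ`, it satisfies
`0 < r j < ‖ζ‖ √(1 - (1 - ‖ζ‖²/(128 M²))²)`. -/
structure IsRadiusChoice {Ω : Type*} [MeasurableSpace Ω] (μ : Measure Ω)
    (ℱ : Filtration ℕ (inferInstance : MeasurableSpace Ω)) (M : ℝ)
    (state : Ω → ℕ → RState n) (r : ℕ → Ω → ℝ) : Prop where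
  adapted : ∀ j, Measurable[ℱ j] (r j)
  range : ∀ᵐ ω ∂μ, ∀ j x ζ, state ω j = .inner x ζ → 0 < r j ω ∧
    r j ω < ‖ζ‖ * Real.sqrt (1 - (1 - ‖ζ‖ ^ 2 / (128 * M ^ 2)) ^ 2)

/-! ### Directional oracles and the nonconvexity modulus -/

/-- `d` is the (one-sided) directional derivative `∇_v h(x)`. -/
def HasDirDeriv (h : E n → ℝ) (x v : E n) (d : ℝ) : Prop :=
  Tendsto (fun t : ℝ => (h (x + t • v) - h x) / t) (𝓝[>] 0) (𝓝 d)

/-- `h` is directionally differentiable and `F` is a directional subgradient map for it: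
`⟨F(x,v), v⟩ = ∇_v h(x)` for all `x`, `v`. -/
def IsDirOracle (h : E n → ℝ) (F : E n → E n → E n) : Prop :=
  ∀ x v, HasDirDeriv h x v ⟪F x v, v⟫_ℝ

/-- The set of all directional subgradients of `h` at `x`. -/
def directional : Subdiff n := fun h x => {ζ | ∃ v, HasDirDeriv h x v ⟪ζ, v⟫_ℝ}

theorem IsDirOracle.mem_directional {h : E n → ℝ} {F : E n → E n → E n}
    (hF : IsDirOracle h F) (x v : E n) : F x v ∈ directional h x := ⟨v, hF x v⟩

/-- The concave deviation `c_δ(ℓ)` of `ℓ : [0,δ] → ℝ`: the infimum of all `K ≥ 0` such that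
`ℓ + s` is convex for some convex `K`-Lipschitz `s` (infinite if there is none). -/
def concaveDeviation (δ : ℝ) (l : ℝ → ℝ) : ℝ≥0∞ :=
  ⨅ (K : ℝ≥0) (_ : ∃ s : ℝ → ℝ, ConvexOn ℝ (Icc 0 δ) s ∧ LipschitzOnWith K s (Icc 0 δ) ∧
    ConvexOn ℝ (Icc 0 δ) (fun r => l r + s r)), (K : ℝ≥0∞)

/-- The nonconvexity modulus `Λ_h(δ)`. -/
def nonconvexityModulus (h : E n → ℝ) (δ : ℝ) : ℝ≥0∞ :=
  ⨆ (x : E n) (y : E n) (_ : ‖x - y‖ ≤ δ),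
    concaveDeviation δ (fun r => h (x + (r / δ) • (y - x)))

/-- The directional subgradient map `H_x(z,v)` for `h_x` built from `F` and `G`; note that
`⟨F(z,v),v⟩` and `⟨G(z,v),v⟩` are the directional derivatives of `f` and `g`. -/
def dirOracle (f g : E n → ℝ) (F G : E n → E n → E n) (x z v : E n) : E n :=
  if g z < f z - f x ∨ (f z - f x = g z ∧ ⟪G z v, v⟫_ℝ ≤ ⟪F z v, v⟫_ℝ) then F z v else G z v

/-! ### The deterministic subroutine inside the outer method -/

/-- States of the method with the deterministic subroutine. -/
inductive BState (n : ℕ) where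
  /-- the subroutine is about to be started at the outer iterate `x` -/
  | call (x : E n)
  /-- inside the `while` loop at `x` with inner vector `ζ`, in the bisection with current
  interval `[a,b]`, whose left end point `a` has not been tested yet -/
  | test (x ζ : E n) (a b : ℝ)
  /-- the same, but `a` has been tested without success, and `[a,b]` is to be halved -/
  | halve (x ζ : E n) (a b : ℝ)
  /-- the method has returned `x` -/
  | done (x : E n)

/-- The unit vector `ζ/‖ζ‖`. -/
def unitVec (ζ : E n) : E n := (1 / ‖ζ‖) • ζ

/-- The point `z(r) = x + (r - δ) ζ/‖ζ‖`. -/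
def linePt (δ : ℝ) (x ζ : E n) (r : ℝ) : E n := x + (r - δ) • unitVec ζ

/-- The function `l(r) = h_x(z(r)) - ε r / 2` on `[0,δ]`. -/
def lineFun (f g : E n → ℝ) (δ ε : ℝ) (x ζ : E n) (r : ℝ) : ℝ :=
  hFun f g x (linePt δ x ζ r) - ε * r / 2

/-- What happens once the inner vector `ζ` has been computed: if the `while` condition holds,
a bisection on `[0,δ]` is started; otherwise the subroutine outputs `ζ`, and the outer method
returns `x` (if `‖ζ‖ ≤ ε`) or moves to `x - δζ/‖ζ‖`. -/
def BState.settle (f g : E n → ℝ) (δ ε : ℝ) (x ζ : E n) : BState n :=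
  if ε < ‖ζ‖ ∧ hFun f g x x - hFun f g x (move δ x ζ) < δ * ε / 3 then .test x ζ 0 δ
  else if ‖ζ‖ ≤ ε then .done x
  else .call (move δ x ζ)

/-- One step. The initial inner vector at `x` is `H_x(x, dir x)` for a direction `dir x`.
The bisection looks for a point `r` at which the right derivative
`⟨H_x(z(r), ζ/‖ζ‖), ζ/‖ζ‖⟩ - ε/2` of `l` is negative: it tests the left end point `a` of the
current interval and, if the test fails, keeps the half on which `l` decreases more (the right
half in case of a tie). If the left half is kept then `a` is not tested again. -/
def BState.step (f g : E n → ℝ) (F G : E n → E n → E n) (δ ε : ℝ) (dir : E n → E n) :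
    BState n → BState n
  | .call x => BState.settle f g δ ε x (dirOracle f g F G x x (dir x))
  | .test x ζ a b =>
      if ⟪dirOracle f g F G x (linePt δ x ζ a) (unitVec ζ), unitVec ζ⟫_ℝ - ε / 2 < 0 then
        BState.settle f g δ ε x
          (minNormSeg ζ (dirOracle f g F G x (linePt δ x ζ a) (unitVec ζ)))
      else .halve x ζ a b
  | .halve x ζ a b =>
      if lineFun f g δ ε x ζ b - lineFun f g δ ε x ζ ((a + b) / 2) ≤
          lineFun f g δ ε x ζ ((a + b) / 2) - lineFun f g δ ε x ζ a then
        .test x ζ ((a + b) / 2) b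
      else .halve x ζ a ((a + b) / 2)
  | .done x => .done x

/-- The number of subgradient oracle calls made in the step out of a state. -/
def BState.cost : BState n → ℕ
  | .call _ => 1
  | .test _ _ _ _ => 1
  | .halve _ _ _ _ => 0
  | .done _ => 0

/-- The state after `j` steps. -/
def bisecState (f g : E n → ℝ) (F G : E n → E n → E n) (δ ε : ℝ) (dir : E n → E n)
    (x₀ : E n) (j : ℕ) : BState n :=
  (BState.step f g F G δ ε dir)^[j] (.call x₀)

end Goldstein

end

open Goldstein

/-!
All three convergence statements rest on one certificate (`isGKKT_of_mem_convexHull`). The methods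
stop with a vector `ζ` of norm at most `σε/(ε+σ+M)` that is a convex combination of oracle values
for `h_x` near `x`. Sorting them by origin, `ζ = (1 - t) a + t b` with `a ∈ ∂_δ f(x)`, `‖a‖ ≤ M`,
and `b ∈ ∂_δ g(x)`; subgradients of `g` occur only if `g(x) ≥ -2Mδ`, and then the constraint
qualification gives `‖b‖ ≥ σ`. Hence `t` stays away from one and `t / (1 - t)` is the multiplier.
Every move of the outer method decreases `h_x` below `h_x(x) = 0`, which keeps the iterates feasible
and decreases `f` by a fixed amount, so that there are finitely many moves
(`IsLocalModel.descent`). This settles the black-box method.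

For the two concrete subroutines, a minimum norm step with an oracle vector `w` such that
`⟪w, ζ⟫ ≤ ‖ζ‖²/2` raises `4M²/‖ζ‖²` by at least one (`norm_minNormSeg_sq_le` and
`add_one_le_div_norm_minNormSeg_sq`).

In the deterministic method such a `w` is found by bisection. If `s` is a convex `K`-Lipschitz
function making the line function `l` plus `s` convex, each unsuccessful test at the left end point
raises by `ε/6` a lower bound for the right slopes of `s` there, corrected by the average slope
of `l` (`BisectInv`); as slopes of `s` lie in `[-K, K]`, there are at most `12K/ε` unsuccessful
tests.

In the randomized method, `⟪w, ζ⟫ ≤ ‖ζ‖²/2` holds only in expectation, by the fundamental theorem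
of calculus for the Lipschitz function `h_x` along a random segment
(`integral_inner_gradOracle_le`); almost every such segment meets the exceptional null set of the
oracles in a null set (`ae_ae_move_notMem`). The whole run is controlled by one potential,
`2 ^ (calls still possible)`, multiplied by `1 - ε²/(2‖ζ‖²)` inside the loop. It contracts in expectation
by the factor `exp(-ε²/(8M²))` with every oracle call
(`IsRandomModel.lintegral_potential_step_le`) and is at least one before termination, so Markov's
inequality gives both the complexity bound and almost sure termination.
-/

namespace Goldstein

/-! ### Goldstein KKT points from short convex combinations -/

/-- A finite maximum of `M`-Lipschitz functions is `M`-Lipschitz. -/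
theorem lipschitzOnWith_maxConstraint {n m : ℕ} (hm : 0 < m) {gs : Fin m → E n → ℝ} {M : ℝ≥0}
    {N : Set (E n)} (h : ∀ i, LipschitzOnWith M (gs i) N) :
    LipschitzOnWith M (maxConstraint gs) N := by
  have : Nonempty (Fin m) := ⟨⟨0, hm⟩⟩
  refine LipschitzOnWith.of_le_add_mul M fun x hx y hy => ?_
  refine ciSup_le fun i => ?_
  have h1 : gs i x ≤ gs i y + M * dist x y := (h i).le_add_mul hx hy
  have h2 : gs i y ≤ maxConstraint gs y := 
    le_ciSup (f := fun i => gs i y) (finite_range _).bddAbove i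
  linarith

/-- Local regularity of the problem data along a method with step length `δ` started in the
feasible set `F`: Lipschitz bounds on the `δ`-balls around feasible points, a description of `F`
by `g ≤ 0` on these balls, and a lower bound `p` for `f` on `F`. -/
structure IsLocalModel {n : ℕ} (f g : E n → ℝ) (F : Set (E n)) (M δ p : ℝ) : Prop where
  lip_f : ∀ x ∈ F, ∀ y ∈ Metric.closedBall x δ, ∀ z ∈ Metric.closedBall x δ,
    |f y - f z| ≤ M * ‖y - z‖
  lip_g : ∀ x ∈ F, ∀ y ∈ Metric.closedBall x δ, ∀ z ∈ Metric.closedBall x δ,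
    |g y - g z| ≤ M * ‖y - z‖
  nonpos : ∀ x ∈ F, g x ≤ 0
  mem : ∀ x ∈ F, ∀ y ∈ Metric.closedBall x δ, g y ≤ 0 → y ∈ F
  bound : ∀ x ∈ F, p ≤ f x

variable {n : ℕ}

theorem closedBall_subset_thickening_of_mem {F : Set (E n)} {x : E n} (hx : x ∈ F) {δ Δ : ℝ}
    (h : δ < Δ) : Metric.closedBall x δ ⊆ Metric.thickening Δ F := fun _ hy =>
  Metric.mem_thickening_iff.2 ⟨x, hx, (Metric.mem_closedBall.1 hy).trans_lt h⟩

theorem isLocalModel_feasible {f g : E n → ℝ} {M : ℝ≥0} {δ Δ p : ℝ} (hδΔ : δ < Δ)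
    (hp : IsGLB (f '' feasible g) p)
    (hf : LipschitzOnWith M f (Metric.thickening Δ (feasible g)))
    (hg : LipschitzOnWith M g (Metric.thickening Δ (feasible g))) :
    IsLocalModel f g (feasible g) M δ p where
  lip_f x hx y hy z hz := by
    have hs := closedBall_subset_thickening_of_mem hx hδΔ
    simpa [Real.dist_eq, dist_eq_norm] using hf.dist_le_mul y (hs hy) z (hs hz)
  lip_g x hx y hy z hz := by
    have hs := closedBall_subset_thickening_of_mem hx hδΔ
    simpa [Real.dist_eq, dist_eq_norm] using hg.dist_le_mul y (hs hy) z (hs hz)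
  nonpos _ hx := hx
  mem _ _ _ _ hy := hy
  bound x hx := hp.1 ⟨x, hx, rfl⟩

theorem move_mem_closedBall {δ : ℝ} (hδ : 0 ≤ δ) (x ζ : E n) :
    move δ x ζ ∈ Metric.closedBall x δ := by
  rw [mem_closedBall_iff_norm, move, sub_sub_cancel_left, norm_neg, norm_smul, norm_div, norm_norm,
    Real.norm_of_nonneg hδ]
  rcases eq_or_ne ‖ζ‖ 0 with h | h
  · simpa [h] using hδ
  · rw [div_mul_cancel₀ _ h]

theorem hFun_self {f g : E n → ℝ} {x : E n} (hx : g x ≤ 0) : hFun f g x x = 0 := by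
  simp [hFun, hx]

/-- A step that decreases `h_x` stays feasible and decreases the objective by as much. -/
theorem IsLocalModel.descent {f g : E n → ℝ} {F : Set (E n)} {M δ p : ℝ}
    (hL : IsLocalModel f g F M δ p) {x y : E n} (hx : x ∈ F) (hy : y ∈ Metric.closedBall x δ)
    {d : ℝ} (hd : 0 ≤ d) (h : d ≤ hFun f g x x - hFun f g x y) : y ∈ F ∧ f y ≤ f x - d := by
  rw [hFun_self (hL.nonpos x hx)] at h
  have h1 : f y - f x ≤ hFun f g x y := le_max_left _ _
  have h2 : g y ≤ hFun f g x y := le_max_right _ _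
  exact ⟨hL.mem x hx y hy (by linarith), by linarith⟩

/-- The core of the convergence theory: a vector `ζ` of norm at most `σε/(ε+σ+M)` that is a convex
combination of short subgradients of `f` and of subgradients of `g` taken where
`f - f(x) ≤ g` certifies that `x` is a Goldstein KKT point. If `ζ = (1-t) a + t b` with
`a ∈ ∂_δ f(x)`, `b ∈ ∂_δ g(x)`, the constraint qualification bounds `t` away from one, and
`t / (1 - t)` is the multiplier. -/
theorem isGKKT_of_mem_convexHull {D : Subdiff n} {f g : E n → ℝ} {F : Set (E n)} {M δ p ε σ : ℝ}
    (hL : IsLocalModel f g F M δ p) (hM : 0 ≤ M) (hδ : 0 < δ) (hε : 0 < ε) (hσ : 0 < σ) {x : E n}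
    (hx : x ∈ F) (hQ : GCQ D (fun _ : Unit => g) δ σ (2 * M * δ) x)
    (hne : (goldstein D g δ x).Nonempty) {ζ : E n}
    (hζ : ζ ∈ convexHull ℝ ({w | ∃ z ∈ Metric.closedBall x δ, w ∈ D f z ∧ ‖w‖ ≤ M} ∪
      {w | ∃ z ∈ Metric.closedBall x δ, w ∈ D g z ∧ f z - f x ≤ g z}))
    (hn : ‖ζ‖ ≤ σ * ε / (ε + σ + M)) :
    IsGKKT D f (fun _ : Unit => g) δ ε (3 * M * δ * (ε + σ + M) / σ) x := by
  have hS : 0 < ε + σ + M := by linarith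
  have hxb : x ∈ Metric.closedBall x δ := Metric.mem_closedBall_self hδ.le
  have hnear : ∀ y ∈ Metric.closedBall x δ, ‖y - x‖ ≤ δ := fun y hy => mem_closedBall_iff_norm.1 hy
  have hεσ : σ * ε / (ε + σ + M) < σ := by
    rw [div_lt_iff₀ hS]; nlinarith
  have hεε : σ * ε / (ε + σ + M) ≤ ε := by
    rw [div_le_iff₀ hS]; nlinarith
  set A : Set (E n) := {w | ∃ z ∈ Metric.closedBall x δ, w ∈ D f z ∧ ‖w‖ ≤ M}
  set B : Set (E n) := {w | ∃ z ∈ Metric.closedBall x δ, w ∈ D g z ∧ f z - f x ≤ g z}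
  have hA : ∀ a ∈ convexHull ℝ A, a ∈ goldstein D f δ x ∧ ‖a‖ ≤ M := by
    intro a ha
    refine ⟨convexHull_mono ?_ ha, ?_⟩
    · rintro w ⟨z, hz, hw, -⟩
      exact mem_iUnion₂.2 ⟨z, hz, hw⟩
    · have : convexHull ℝ A ⊆ Metric.closedBall 0 M := by
        refine convexHull_min ?_ (convex_closedBall _ _)
        rintro w ⟨z, hz, hw, hw'⟩
        simpa using hw'
      simpa using this ha
  have hB : ∀ b ∈ convexHull ℝ B, b ∈ goldstein D g δ x ∧ σ ≤ ‖b‖ ∧ - (2 * M * δ) ≤ g x := by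
    intro b hb
    have hb' : b ∈ goldstein D g δ x := by
      refine convexHull_mono ?_ hb
      rintro w ⟨z, hz, hw, -⟩
      exact mem_iUnion₂.2 ⟨z, hz, hw⟩
    obtain ⟨w, z, hz, -, hzg⟩ : B.Nonempty := convexHull_nonempty_iff.1 ⟨b, hb⟩
    have h1 := abs_le.1 (hL.lip_f x hx z hz x hxb)
    have h2 := abs_le.1 (hL.lip_g x hx z hz x hxb)
    have h3 := mul_le_mul_of_nonneg_left (hnear z hz) hM
    have hgx : - (2 * M * δ) ≤ g x := by linarith [h1.1, h2.2]
    refine ⟨hb', ?_, hgx⟩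
    have := hQ (fun _ => 1) (fun _ => zero_le_one) (by simp) (fun _ h => by linarith)
    simp only [Finset.univ_unique, Finset.sum_singleton, one_smul] at this
    have h4 := this.trans (Metric.infEDist_le_edist_of_mem hb')
    rw [edist_dist, dist_zero_left] at h4
    exact (ENNReal.ofReal_le_ofReal_iff (norm_nonneg _)).1 h4
  -- It suffices to exhibit the two vectors and the multiplier.
  suffices H : ∃ a ∈ goldstein D f δ x, ∃ b ∈ goldstein D g δ x, ∃ l : ℝ, 0 ≤ l ∧
      ‖a + l • b‖ ≤ ε ∧ (l = 0 ∨ l * σ ≤ ε + M ∧ - (2 * M * δ) ≤ g x) by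
    obtain ⟨a, ha, b, hb, l, hl, hab, hl'⟩ := H
    refine ⟨fun _ => hL.nonpos x hx, fun _ => l, fun _ => hl, ?_, ?_⟩
    · simp only [Finset.univ_unique, Finset.sum_singleton]
      refine (Metric.infEDist_le_edist_of_mem (Set.add_mem_add ha (smul_mem_smul_set hb))).trans ?_
      rw [edist_dist, dist_zero_left]
      exact ENNReal.ofReal_le_ofReal hab
    · intro _ y hy
      have hη : 0 ≤ 3 * M * δ * (ε + σ + M) / σ := by positivity
      rcases hl' with rfl | ⟨hlσ, hgx⟩
      · simpa using hη
      have h2 := abs_le.1 (hL.lip_g x hx y hy x hxb)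
      have h3 := mul_le_mul_of_nonneg_left (hnear y hy) hM
      have h4 : |g y| ≤ 3 * M * δ := by
        have := hL.nonpos x hx
        rw [abs_le]; constructor <;> nlinarith [h2.1, h2.2, mul_nonneg hM hδ.le]
      rw [abs_mul, abs_of_nonneg hl, le_div_iff₀ hσ]
      calc l * |g y| * σ = (l * σ) * |g y| := by ring
        _ ≤ (ε + σ + M) * (3 * M * δ) :=
          mul_le_mul (by linarith) h4 (abs_nonneg _) hS.le
        _ = 3 * M * δ * (ε + σ + M) := by ring
  obtain ⟨b₀, hb₀⟩ := hne
  rcases A.eq_empty_or_nonempty with hA0 | hA0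
  · rw [hA0, empty_union] at hζ
    linarith [(hB ζ hζ).2.1]
  rcases B.eq_empty_or_nonempty with hB0 | hB0
  · rw [hB0, union_empty] at hζ
    exact ⟨ζ, (hA ζ hζ).1, b₀, hb₀, 0, le_rfl, by simpa using hn.trans hεε, .inl rfl⟩
  rw [convexHull_union hA0 hB0, mem_convexJoin] at hζ
  obtain ⟨a, ha, b, hb, s, t, hs, ht, hst, rfl⟩ := hζ
  obtain ⟨ha1, ha2⟩ := hA a ha
  obtain ⟨hb1, hb2, hgx⟩ := hB b hb
  have key : t * ‖b‖ ≤ ‖s • a + t • b‖ + s * M := by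
    have h1 : t • b = (s • a + t • b) - s • a := by abel
    calc t * ‖b‖ = ‖t • b‖ := by rw [norm_smul, Real.norm_of_nonneg ht]
      _ ≤ ‖s • a + t • b‖ + ‖s • a‖ := by rw [h1]; simpa using norm_sub_le (s • a + t • b) (s • a)
      _ ≤ _ := by
        rw [norm_smul, Real.norm_of_nonneg hs]
        gcongr
  have key2 : t * σ ≤ σ * ε / (ε + σ + M) + s * M :=
    (mul_le_mul_of_nonneg_left hb2 ht).trans (key.trans (by linarith))
  have hs1 : σ / (ε + σ + M) ≤ s := by
    rw [div_le_iff₀ hS]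
    have h1 : σ * ε / (ε + σ + M) * (ε + σ + M) = σ * ε := div_mul_cancel₀ _ hS.ne'
    have h2 : t = 1 - s := by linarith
    have h3 : σ ≤ σ * ε / (ε + σ + M) + s * (M + σ) := by rw [h2] at key2; linarith
    have h4 := mul_le_mul_of_nonneg_right h3 hS.le
    have h5 : σ * (σ + M) ≤ s * (ε + σ + M) * (σ + M) := by nlinarith
    exact le_of_mul_le_mul_right h5 (by linarith)
  have hs0 : 0 < s := (div_pos hσ hS).trans_le hs1
  have hsmall : ‖a + (t / s) • b‖ ≤ ε := by
    have h1 : a + (t / s) • b = s⁻¹ • (s • a + t • b) := by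
      rw [smul_add, smul_smul, smul_smul, inv_mul_cancel₀ hs0.ne', one_smul, div_eq_inv_mul]
    rw [h1, norm_smul, norm_inv, Real.norm_of_nonneg hs, inv_mul_le_iff₀ hs0]
    calc _ ≤ σ * ε / (ε + σ + M) := hn
      _ = σ / (ε + σ + M) * ε := by ring
      _ ≤ s * ε := by gcongr
  refine ⟨a, ha1, b, hb1, t / s, by positivity, hsmall, .inr ⟨?_, hgx⟩⟩
  calc t / s * σ ≤ ‖(t / s) • b‖ := by
        rw [norm_smul, Real.norm_of_nonneg (by positivity)]; gcongr
    _ = ‖(a + (t / s) • b) - a‖ := by rw [add_sub_cancel_left]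
    _ ≤ ‖a + (t / s) • b‖ + ‖a‖ := norm_sub_le _ _
    _ ≤ ε + M := add_le_add hsmall ha2

/-! ### The black-box subroutine -/

theorem exists_isGKKT_of_isRun {D : Subdiff n} {f g : E n → ℝ} {N : Set (E n)}
    {M δ p ε σ C : ℝ} (hL : IsLocalModel f g (feasible g) M δ p)
    (hN : ∀ x ∈ feasible g, Metric.closedBall x δ ⊆ N) (hM : 0 ≤ M) (hδ : 0 < δ) (hε : 0 < ε)
    (hσ : 0 < σ) (hQ : ∀ x ∈ feasible g, GCQ D (fun _ : Unit => g) δ σ (2 * M * δ) x)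
    {Gf Gg : E n → E n} {Gh : E n → E n → E n} (hO : IsOracle D f g N M Gf Gg Gh) (hC : 0 < C)
    {x₀ : E n} (hx₀ : g x₀ ≤ 0) {x ζ : ℕ → E n}
    (hr : IsRun f g Gh C δ (σ * ε / (ε + σ + M)) x₀ x ζ) :
    ∃ K, (∀ j < K, σ * ε / (ε + σ + M) < ‖ζ j‖) ∧ ‖ζ K‖ ≤ σ * ε / (ε + σ + M) ∧
      IsGKKT D f (fun _ : Unit => g) δ ε (3 * M * δ * (ε + σ + M) / σ) (x K) := by
  set e := σ * ε / (ε + σ + M)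
  have he : 0 < e := by positivity
  have hd : 0 < C * δ * e := by positivity
  have hind : ∀ k, (∀ j < k, e < ‖ζ j‖) → x k ∈ feasible g ∧ f (x k) ≤ f x₀ - k * (C * δ * e) := by
    intro k
    induction k with
    | zero => intro _; simpa [hr.init, feasible] using hx₀
    | succ k ih =>
      intro hk
      obtain ⟨h1, h2⟩ := ih fun j hj => hk j (by omega)
      have h3 := (hr.output k fun j hj => hk j (by omega)).2.resolve_left
        (not_le.2 (hk k (by omega)))
      rw [hr.next k fun j hj => hk j (by omega)]
      obtain ⟨h4, h5⟩ := hL.descent h1 (move_mem_closedBall hδ.le (x k) (ζ k)) hd.le h3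
      refine ⟨h4, ?_⟩
      push_cast
      linarith
  have hex : ∃ K, ‖ζ K‖ ≤ e := by
    by_contra! hcon
    obtain ⟨k, hk⟩ := exists_nat_gt ((f x₀ - p) / (C * δ * e))
    obtain ⟨h1, h2⟩ := hind k fun j _ => hcon j
    rw [div_lt_iff₀ hd] at hk
    linarith [hL.bound _ h1]
  classical
  have hmin : ∀ j < Nat.find hex, e < ‖ζ j‖ := fun j hj => not_le.1 (Nat.find_min hex hj)
  refine ⟨Nat.find hex, hmin, Nat.find_spec hex, ?_⟩
  set K := Nat.find hex
  have hxK := (hind K hmin).1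
  obtain ⟨⟨t, z, w, hz, hw, hw1, hζ⟩, -⟩ := hr.output K hmin
  refine isGKKT_of_mem_convexHull hL hM hδ hε hσ hxK (hQ _ hxK) ?_ ?_ (Nat.find_spec hex)
  · refine ⟨Gg (x K), subset_convexHull _ _ (mem_iUnion₂.2 ⟨x K, ?_, hO.mem_g _ (hN _ hxK ?_)⟩)⟩ <;>
      exact Metric.mem_closedBall_self hδ.le
  · rw [hζ]
    refine (convex_convexHull ℝ _).sum_mem (fun i _ => hw i) hw1 fun i _ =>
      subset_convexHull _ _ ?_
    have hzN := hN _ hxK (hz i)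
    have hf : Gf (z i) ∈ {w | ∃ y ∈ Metric.closedBall (x K) δ, w ∈ D f y ∧ ‖w‖ ≤ M} :=
      ⟨z i, hz i, hO.mem_f _ hzN, hO.norm_f _ hzN⟩
    rcases lt_trichotomy (g (z i)) (f (z i) - f (x K)) with h | h | h
    · rw [hO.of_gt _ hxK _ hzN h]
      exact .inl hf
    · rcases hO.of_eq _ hxK _ hzN h.symm with h' | h' <;> rw [h']
      · exact .inl hf
      · exact .inr ⟨z i, hz i, hO.mem_g _ hzN, h.ge⟩
    · rw [hO.of_lt _ hxK _ hzN h]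
      exact .inr ⟨z i, hz i, hO.mem_g _ hzN, h.le⟩

/-! ### Decrease of the norm in a minimum norm step -/

/-- One minimum norm step. The bound is affine in `⟪b, a⟫`, so that it may be averaged over a random
`b`; if `⟪b, a⟫ ≤ ‖a‖² / 2` the last term is nonpositive. It is obtained by testing minimality
with the point of parameter `‖a‖² / (2 M²)` of the segment. -/
theorem norm_minNormSeg_sq_le {a b : E n} {M : ℝ} (hM : 0 < M) (ha : ‖a‖ ≤ M) (hb : ‖b‖ ≤ M) :
    ‖minNormSeg a b‖ ^ 2 ≤ ‖a‖ ^ 2 - (‖a‖ ^ 2) ^ 2 / (4 * M ^ 2) +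
      2 * (‖a‖ ^ 2 / (2 * M ^ 2)) * (1 - ‖a‖ ^ 2 / (2 * M ^ 2)) * (⟪b, a⟫_ℝ - ‖a‖ ^ 2 / 2) := by
  have hM2 : 0 < M ^ 2 := by positivity
  have hq : ‖a‖ ^ 2 ≤ M ^ 2 := by gcongr
  have hb2 : ‖b‖ ^ 2 ≤ M ^ 2 := by gcongr
  obtain ⟨t, ht⟩ : ∃ t, t = ‖a‖ ^ 2 / (2 * M ^ 2) := ⟨_, rfl⟩
  have htq : ‖a‖ ^ 2 = 2 * t * M ^ 2 := by rw [ht]; field_simp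
  have ht0 : 0 ≤ t := by rw [ht]; positivity
  have ht1 : t ≤ 1 := by rw [ht, div_le_one (by positivity)]; linarith
  have hmem : (1 - t) • a + t • b ∈ segment ℝ a b := ⟨1 - t, t, by linarith, ht0, by ring, rfl⟩
  have h1 := norm_minNormSeg_le a b _ hmem
  have h2 : ‖minNormSeg a b‖ ^ 2 ≤ ‖(1 - t) • a + t • b‖ ^ 2 := by gcongr
  have h3 : ‖(1 - t) • a + t • b‖ ^ 2 =
      (1 - t) ^ 2 * ‖a‖ ^ 2 + 2 * (1 - t) * t * ⟪b, a⟫_ℝ + t ^ 2 * ‖b‖ ^ 2 := by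
    rw [norm_add_sq_real, norm_smul, norm_smul, inner_smul_left, inner_smul_right,
      real_inner_comm a b, mul_pow, mul_pow, Real.norm_eq_abs, Real.norm_eq_abs, sq_abs, sq_abs]
    simp only [conj_trivial]
    ring
  rw [← ht]
  have h4 : (‖a‖ ^ 2) ^ 2 / (4 * M ^ 2) = t * ‖a‖ ^ 2 - t ^ 2 * M ^ 2 := by
    rw [htq]; field_simp; ring
  rw [h4]
  have h5 : t ^ 2 * ‖b‖ ^ 2 ≤ t ^ 2 * M ^ 2 := by gcongr
  nlinarith

/-- If `⟪b, a⟫ ≤ ‖a‖² / 2`, a minimum norm step raises `4 M² / ‖·‖²` by at least one. -/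
theorem add_one_le_div_norm_minNormSeg_sq {a b : E n} {M : ℝ} (hM : 0 < M) (ha : ‖a‖ ≤ M)
    (hb : ‖b‖ ≤ M) (hab : ⟪b, a⟫_ℝ ≤ ‖a‖ ^ 2 / 2) (h0 : minNormSeg a b ≠ 0) (ha0 : a ≠ 0) :
    4 * M ^ 2 / ‖a‖ ^ 2 + 1 ≤ 4 * M ^ 2 / ‖minNormSeg a b‖ ^ 2 := by
  have h := norm_minNormSeg_sq_le hM ha hb
  have hM2 : 0 < M ^ 2 := by positivity
  have hq0 : 0 < ‖a‖ ^ 2 := by positivity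
  have hq : ‖a‖ ^ 2 ≤ M ^ 2 := by gcongr
  have hr0 : 0 < ‖minNormSeg a b‖ ^ 2 := by positivity
  have ht : ‖a‖ ^ 2 / (2 * M ^ 2) ≤ 1 := by rw [div_le_one (by positivity)]; linarith
  have h1 : 2 * (‖a‖ ^ 2 / (2 * M ^ 2)) * (1 - ‖a‖ ^ 2 / (2 * M ^ 2)) *
      (⟪b, a⟫_ℝ - ‖a‖ ^ 2 / 2) ≤ 0 :=
    mul_nonpos_of_nonneg_of_nonpos (mul_nonneg (by positivity) (by linarith)) (by linarith)
  set q := ‖a‖ ^ 2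
  have h2 : ‖minNormSeg a b‖ ^ 2 ≤ q - q ^ 2 / (4 * M ^ 2) := by linarith
  rw [le_div_iff₀ hr0]
  calc (4 * M ^ 2 / q + 1) * ‖minNormSeg a b‖ ^ 2
      ≤ (4 * M ^ 2 / q + 1) * (q - q ^ 2 / (4 * M ^ 2)) := by gcongr
    _ = 4 * M ^ 2 - q ^ 2 / (4 * M ^ 2) := by field_simp; ring
    _ ≤ 4 * M ^ 2 := by
      have : 0 ≤ q ^ 2 / (4 * M ^ 2) := by positivity
      linarith

theorem norm_minNormSeg_le_left (a b : E n) : ‖minNormSeg a b‖ ≤ ‖a‖ :=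
  norm_minNormSeg_le a b a (left_mem_segment ℝ a b)

/-! ### Convexification along segments -/

theorem exists_convexOn_add_of_nonconvexityModulus_lt {h : E n → ℝ} {δ : ℝ} {K : ℝ≥0}
    (hK : nonconvexityModulus h δ < K) {x y : E n} (hxy : ‖x - y‖ ≤ δ) :
    ∃ s : ℝ → ℝ, ConvexOn ℝ (Icc 0 δ) s ∧ LipschitzOnWith K s (Icc 0 δ) ∧
      ConvexOn ℝ (Icc 0 δ) (fun r => h (x + (r / δ) • (y - x)) + s r) := by
  have h1 : concaveDeviation δ (fun r => h (x + (r / δ) • (y - x))) < K :=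
    lt_of_le_of_lt (le_iSup_of_le x (le_iSup_of_le y (le_iSup
      (fun _ : ‖x - y‖ ≤ δ => concaveDeviation δ fun r => h (x + (r / δ) • (y - x))) hxy))) hK
  simp only [concaveDeviation, iInf_lt_iff] at h1
  obtain ⟨K', ⟨s, hs1, hs2, hs3⟩, hlt⟩ := h1
  exact ⟨s, hs1, hs2.weaken (by exact_mod_cast hlt.le), hs3⟩

theorem norm_unitVec {ζ : E n} (h : ζ ≠ 0) : ‖unitVec ζ‖ = 1 := by
  rw [unitVec, norm_smul, norm_div, norm_one, norm_norm, one_div,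
    inv_mul_cancel₀ (norm_ne_zero_iff.2 h)]

theorem linePt_right (δ : ℝ) (x ζ : E n) : linePt δ x ζ δ = x := by simp [linePt]

theorem linePt_zero (δ : ℝ) (x ζ : E n) : linePt δ x ζ 0 = move δ x ζ := by
  rw [linePt, move, unitVec, smul_smul, zero_sub, neg_mul, neg_smul, mul_one_div, sub_eq_add_neg]

theorem linePt_add (δ : ℝ) (x ζ : E n) (a t : ℝ) :
    linePt δ x ζ (a + t) = linePt δ x ζ a + t • unitVec ζ := by
  simp only [linePt]; module

theorem linePt_mem_closedBall {δ : ℝ} (x : E n) {ζ : E n} (h : ζ ≠ 0) {a : ℝ} (ha : a ∈ Icc 0 δ) :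
    linePt δ x ζ a ∈ Metric.closedBall x δ := by
  rw [mem_closedBall_iff_norm, linePt, add_sub_cancel_left, norm_smul, norm_unitVec h, mul_one,
    Real.norm_eq_abs, abs_le]
  constructor <;> linarith [ha.1, ha.2]

/-- Convexity defects of `f` and `g` add up for their maximum, since
`max f g + (s₁ + s₂) = max (f + s₁ + s₂) (g + s₂ + s₁)`. -/
theorem exists_convexOn_lineFun_add {f g : E n → ℝ} {δ : ℝ} (hδ : 0 < δ) {K₁ K₂ : ℝ≥0}
    (h₁ : nonconvexityModulus f δ < K₁) (h₂ : nonconvexityModulus g δ < K₂) (ε : ℝ) (x : E n)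
    {ζ : E n} (hζ : ζ ≠ 0) :
    ∃ s : ℝ → ℝ, ConvexOn ℝ (Icc 0 δ) s ∧ LipschitzOnWith (K₁ + K₂) s (Icc 0 δ) ∧
      ConvexOn ℝ (Icc 0 δ) (fun r => lineFun f g δ ε x ζ r + s r) := by
  have hseg : ∀ r : ℝ, linePt δ x ζ 0 + (r / δ) • (x - linePt δ x ζ 0) = linePt δ x ζ r := by
    intro r
    have h1 : x - linePt δ x ζ 0 = δ • unitVec ζ := by simp only [linePt]; module
    rw [h1, smul_smul, div_mul_cancel₀ _ hδ.ne', ← linePt_add, zero_add]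
  have hnorm : ‖linePt δ x ζ 0 - x‖ ≤ δ :=
    mem_closedBall_iff_norm.1 (linePt_mem_closedBall x hζ ⟨le_rfl, hδ.le⟩)
  obtain ⟨s₁, hs1, hs2, hs3⟩ := exists_convexOn_add_of_nonconvexityModulus_lt h₁ hnorm
  obtain ⟨s₂, ht1, ht2, ht3⟩ := exists_convexOn_add_of_nonconvexityModulus_lt h₂ hnorm
  simp only [hseg] at hs3 ht3
  have hlin : ConvexOn ℝ (Icc 0 δ) (fun r : ℝ => - (ε / 2) * r) := by
    refine ⟨convex_Icc _ _, fun u _ v _ a b _ _ _ => le_of_eq ?_⟩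
    simp only [smul_eq_mul]; ring
  refine ⟨fun r => s₁ r + s₂ r, hs1.add ht1, hs2.add ht2, ?_⟩
  have hmax := (((hs3.add ht1).add_const (-f x)).sup (ht3.add hs1)).add hlin
  refine hmax.congr fun r _ => ?_
  simp only [lineFun, hFun, Pi.add_apply, Pi.sup_apply]
  rw [show f (linePt δ x ζ r) + s₁ r + s₂ r + -f x
      = (f (linePt δ x ζ r) - f x) + (s₁ r + s₂ r) by ring,
    show g (linePt δ x ζ r) + s₂ r + s₁ r = g (linePt δ x ζ r) + (s₁ r + s₂ r) by ring,
    max_add_add_right]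
  ring

/-! ### The bisection -/

/-- The oracle value is a lower bound for the one-sided slope of `h_x`: it belongs to a function
below `h_x` that agrees with `h_x` at the base point. -/
theorem eventually_mul_le_hFun_sub {f g : E n → ℝ} {F G : E n → E n → E n} (hF : IsDirOracle f F)
    (hG : IsDirOracle g G) (x z v : E n) {c : ℝ} (hc : c < ⟪dirOracle f g F G x z v, v⟫_ℝ) :
    ∀ᶠ t : ℝ in 𝓝[>] 0, c * t ≤ hFun f g x (z + t • v) - hFun f g x z := by
  unfold dirOracle at hc
  split_ifs at hc with h
  · filter_upwards [(hF z v).eventually_const_lt hc, self_mem_nhdsWithin] with t ht ht0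
    have h1 : hFun f g x z = f z - f x := max_eq_left (h.elim le_of_lt fun h => h.1.ge)
    have h2 : f (z + t • v) - f x ≤ hFun f g x (z + t • v) := le_max_left _ _
    rw [lt_div_iff₀ ht0] at ht
    linarith
  · filter_upwards [(hG z v).eventually_const_lt hc, self_mem_nhdsWithin] with t ht ht0
    have h1 : hFun f g x z = g z := max_eq_right (not_lt.1 fun h' => h (.inl h'))
    have h2 : g (z + t • v) ≤ hFun f g x (z + t • v) := le_max_right _ _
    rw [lt_div_iff₀ ht0] at ht
    linarith

/-- The invariant of the bisection for `l`, with convexifier `s` of Lipschitz constant `K`: on the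
current interval `[a, b]` the function `l` decreases at average rate more than `γ`, and the right
slopes of `s` at `a` are at least `c - K` plus the (negative) average slope of `l`. Since the slopes
of `s` lie in `[-K, K]`, the number `c`, which grows by `γ` with every failed test, stays below
`2 K`. -/
structure BisectInv (l s : ℝ → ℝ) (δ K γ c a b : ℝ) : Prop where
  nonneg : 0 ≤ a
  lt : a < b
  le : b ≤ δ
  slope : (l b - l a) / (b - a) < -γ
  conv : ∀ t ∈ Ioc a δ, c - K + (l b - l a) / (b - a) ≤ (s t - s a) / (t - a)

/-- The lower right derivative of `l` at `a` is nonnegative. -/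
def RightNonneg (l : ℝ → ℝ) (a : ℝ) : Prop :=
  ∀ c < 0, ∀ᶠ t : ℝ in 𝓝[>] 0, c * t ≤ l (a + t) - l a

section Bisection

variable {l s : ℝ → ℝ} {δ K γ c a b : ℝ}

theorem BisectInv.le_slope_add_slope (h : BisectInv l s δ K γ c a b) (hr : RightNonneg l a)
    (hls : ConvexOn ℝ (Icc 0 δ) (fun r => l r + s r)) {m : ℝ} (hm : m ∈ Ioc a δ) :
    c - K + (l b - l a) / (b - a) ≤ (l m - l a) / (m - a) + (s m - s a) / (m - a) := by
  refine le_of_forall_lt fun y hy => ?_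
  set d := c - K + (l b - l a) / (b - a)
  have hma : 0 < m - a := sub_pos.2 hm.1
  obtain ⟨t, ht, ht0, htm⟩ := ((hr ((y - d) / 2) (by linarith)).and
    (Ioo_mem_nhdsGT hma)).exists
  have h1 : a + t ∈ Ioc a δ := ⟨by linarith, by linarith [hm.2]⟩
  have h2 := hls.secant_mono (a := a) (x := a + t) (y := m) ⟨h.nonneg, by linarith [hm.1, hm.2]⟩
    ⟨by linarith [h.nonneg], h1.2⟩ ⟨by linarith [hm.1, h.nonneg], hm.2⟩ (by linarith)
    hm.1.ne' (by linarith)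
  have h3 := h.conv _ h1
  have h4 : (y - d) / 2 ≤ (l (a + t) - l a) / (a + t - a) := by
    rw [add_sub_cancel_left, le_div_iff₀ ht0]; exact ht
  have h5 : (l (a + t) + s (a + t) - (l a + s a)) / (a + t - a) =
    (l (a + t) - l a) / (a + t - a) + (s (a + t) - s a) / (a + t - a) := by ring
  have h6 : (l m + s m - (l a + s a)) / (m - a) =
    (l m - l a) / (m - a) + (s m - s a) / (m - a) := by ring
  rw [h5, h6] at h2
  linarith

theorem BisectInv.le_two_mul (h : BisectInv l s δ K γ c a b) (hr : RightNonneg l a)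
    (hls : ConvexOn ℝ (Icc 0 δ) (fun r => l r + s r))
    (hs : ∀ u ∈ Icc 0 δ, ∀ v ∈ Icc 0 δ, |s u - s v| ≤ K * |u - v|) : c ≤ 2 * K := by
  have h1 := h.le_slope_add_slope hr hls ⟨h.lt, h.le⟩
  have hba : 0 < b - a := sub_pos.2 h.lt
  have h2 : (s b - s a) / (b - a) ≤ K := by
    rw [div_le_iff₀ hba]
    have := hs b ⟨by linarith [h.nonneg], h.le⟩ a ⟨h.nonneg, by linarith [h.le]⟩
    rw [abs_of_pos hba] at this
    exact (le_abs_self _).trans this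
  linarith

theorem BisectInv.left (h : BisectInv l s δ K γ c a b)
    (hh : ¬ l b - l ((a + b) / 2) ≤ l ((a + b) / 2) - l a) :
    BisectInv l s δ K γ c a ((a + b) / 2) := by
  have hba : 0 < b - a := sub_pos.2 h.lt
  have key : (l ((a + b) / 2) - l a) / ((a + b) / 2 - a) ≤ (l b - l a) / (b - a) := by
    rw [show (a + b) / 2 - a = (b - a) / 2 by ring, div_le_div_iff₀ (by linarith) hba]
    nlinarith [not_le.1 hh]
  exact ⟨h.nonneg, by linarith [h.lt], by linarith [h.le, h.lt], key.trans_lt h.slope,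
    fun t ht => (by linarith : _ ≤ _).trans (h.conv t ht)⟩

/-- After a failed test at `a`, keeping the right half raises the level `c` of the invariant
by `γ`. -/
theorem BisectInv.right (h : BisectInv l s δ K γ c a b) (hr : RightNonneg l a)
    (hs : ConvexOn ℝ (Icc 0 δ) s) (hls : ConvexOn ℝ (Icc 0 δ) (fun r => l r + s r))
    (hh : l b - l ((a + b) / 2) ≤ l ((a + b) / 2) - l a) :
    BisectInv l s δ K γ (c + γ) ((a + b) / 2) b := by
  have hba : 0 < b - a := sub_pos.2 h.lt
  obtain ⟨m, hm⟩ : ∃ m, m = (a + b) / 2 := ⟨_, rfl⟩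
  rw [← hm] at hh ⊢
  have hma : m - a = (b - a) / 2 := by rw [hm]; ring
  have hbm : b - m = (b - a) / 2 := by rw [hm]; ring
  have key : (l b - l m) / (b - m) = 2 * ((l b - l a) / (b - a)) - (l m - l a) / (m - a) := by
    rw [hma, hbm]; field_simp; ring
  have key2 : (l b - l m) / (b - m) ≤ (l b - l a) / (b - a) := by
    rw [hbm, div_le_div_iff₀ (by linarith) hba]; nlinarith
  have hm0 : 0 ≤ m := by linarith [h.nonneg]
  have hmδ : m ≤ δ := by linarith [h.le]
  have h1 := h.le_slope_add_slope hr hls (m := m) ⟨by linarith, hmδ⟩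
  refine ⟨hm0, by linarith, h.le, key2.trans_lt h.slope, fun t ht => ?_⟩
  have h2 := hs.slope_mono_adjacent (x := a) (y := m) (z := t) ⟨h.nonneg, by linarith [h.le]⟩
    ⟨by linarith [ht.1], ht.2⟩ (by linarith) ht.1
  rw [key]
  linarith [h.slope]

end Bisection

/-! ### The deterministic method -/

section Deterministic

variable {f g : E n → ℝ} {F G : E n → E n → E n} {δ ε : ℝ} {dir : E n → E n}

/-- The method gets from `s` to `s'` in finitely many steps that make at most `c` oracle calls. -/
def Reach (f g : E n → ℝ) (F G : E n → E n → E n) (δ ε : ℝ) (dir : E n → E n) (c : ℕ)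
    (s s' : BState n) : Prop :=
  ∃ t : ℕ, (BState.step f g F G δ ε dir)^[t] s = s' ∧
    ∑ j ∈ Finset.range t, ((BState.step f g F G δ ε dir)^[j] s).cost ≤ c

theorem Reach.refl (c : ℕ) (s : BState n) : Reach f g F G δ ε dir c s s :=
  ⟨0, rfl, by simp⟩

theorem Reach.step (s : BState n) :
    Reach f g F G δ ε dir s.cost s (BState.step f g F G δ ε dir s) :=
  ⟨1, rfl, by simp⟩

theorem Reach.trans {c c' : ℕ} {s s' s'' : BState n} (h : Reach f g F G δ ε dir c s s')
    (h' : Reach f g F G δ ε dir c' s' s'') : Reach f g F G δ ε dir (c + c') s s'' := by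
  obtain ⟨t, rfl, ht⟩ := h
  obtain ⟨t', rfl, ht'⟩ := h'
  refine ⟨t + t', by rw [add_comm, Function.iterate_add_apply], ?_⟩
  rw [Finset.sum_range_add]
  refine add_le_add ht (le_trans (Finset.sum_le_sum fun j _ => ?_) ht')
  rw [add_comm, Function.iterate_add_apply]

theorem Reach.mono {c c' : ℕ} {s s' : BState n} (h : Reach f g F G δ ε dir c s s') (hc : c ≤ c') :
    Reach f g F G δ ε dir c' s s' := by
  obtain ⟨t, h1, h2⟩ := h
  exact ⟨t, h1, h2.trans hc⟩

/-- The data of a bisection at `x` with inner vector `ζ`: the convexifier `s` of the line function,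
and a bound `L` for the number of unsuccessful tests. -/
structure IsConvexifier (f g : E n → ℝ) (δ ε K : ℝ) (L : ℕ) (x ζ : E n) (s : ℝ → ℝ) : Prop where
  conv : ConvexOn ℝ (Icc 0 δ) s
  lip : ∀ u ∈ Icc 0 δ, ∀ v ∈ Icc 0 δ, |s u - s v| ≤ K * |u - v|
  conv_add : ConvexOn ℝ (Icc 0 δ) (fun r => lineFun f g δ ε x ζ r + s r)
  bound : 2 * K / (ε / 6) < L + 1

theorem rightNonneg_lineFun (hF : IsDirOracle f F) (hG : IsDirOracle g G) {x ζ : E n} {a : ℝ}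
    (h : ¬ ⟪dirOracle f g F G x (linePt δ x ζ a) (unitVec ζ), unitVec ζ⟫_ℝ - ε / 2 < 0) :
    RightNonneg (lineFun f g δ ε x ζ) a := by
  intro c hc
  filter_upwards [eventually_mul_le_hFun_sub hF hG x (linePt δ x ζ a) (unitVec ζ)
    (c := c + ε / 2) (by linarith)] with t ht
  simp only [lineFun, linePt_add]
  linarith

/-- Once the left end point has been tested without success, halving reaches, without oracle calls,
an interval with a new left end point: otherwise intervals `[a, b]` with `b → a` would contradict
`RightNonneg`. -/
theorem reach_halve (x ζ : E n) {a : ℝ}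
    (hr : RightNonneg (lineFun f g δ ε x ζ) a) {s : ℝ → ℝ} {K c γ : ℝ} (hγ : 0 < γ)
    (hs : ConvexOn ℝ (Icc 0 δ) s)
    (hls : ConvexOn ℝ (Icc 0 δ) (fun r => lineFun f g δ ε x ζ r + s r)) {b : ℝ}
    (h : BisectInv (lineFun f g δ ε x ζ) s δ K γ c a b) :
    ∃ a' b', BisectInv (lineFun f g δ ε x ζ) s δ K γ (c + γ) a' b' ∧
      Reach f g F G δ ε dir 0 (.halve x ζ a b) (.test x ζ a' b') := by
  obtain ⟨ρ, hρ, hρl⟩ := mem_nhdsGT_iff_exists_Ioo_subset.1 (hr (-γ) (by linarith))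
  have key : ∀ N : ℕ, ∀ b, BisectInv (lineFun f g δ ε x ζ) s δ K γ c a b → b - a < ρ * 2 ^ N →
      ∃ a' b', BisectInv (lineFun f g δ ε x ζ) s δ K γ (c + γ) a' b' ∧
      Reach f g F G δ ε dir 0 (.halve x ζ a b) (.test x ζ a' b') := by
    intro N
    induction N with
    | zero =>
      intro b h hb
      have h1 : -γ * (b - a) ≤ lineFun f g δ ε x ζ (a + (b - a)) - lineFun f g δ ε x ζ a :=
        hρl ⟨sub_pos.2 h.lt, by simpa using hb⟩
      have h2 := h.slope
      rw [div_lt_iff₀ (sub_pos.2 h.lt)] at h2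
      rw [add_sub_cancel] at h1
      linarith
    | succ N ih =>
      intro b h hb
      have hstep := Reach.step (f := f) (g := g) (F := F) (G := G) (δ := δ) (ε := ε) (dir := dir)
        (.halve x ζ a b)
      simp only [BState.step, BState.cost] at hstep
      split_ifs at hstep with hh
      · exact ⟨_, _, h.right hr hs hls hh, hstep⟩
      · obtain ⟨a', b', h1, h2⟩ := ih _ (h.left hh) (by rw [pow_succ] at hb; linarith)
        exact ⟨a', b', h1, hstep.trans h2⟩
  obtain ⟨N, hN⟩ := pow_unbounded_of_one_lt ((b - a) / ρ) one_lt_two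
  exact key N b h (by rwa [div_lt_iff₀ hρ, mul_comm] at hN)

/-- The bisection finds a vector with small inner product after at most `L` unsuccessful tests. -/
theorem reach_test (hF : IsDirOracle f F) (hG : IsDirOracle g G) (hε : 0 < ε) {K : ℝ} {L : ℕ}
    {x ζ : E n} {s : ℝ → ℝ} (hc : IsConvexifier f g δ ε K L x ζ s) (j : ℕ) :
    ∀ k, k + j = L → ∀ a b,
      BisectInv (lineFun f g δ ε x ζ) s δ K (ε / 6) ((k + 1) * (ε / 6)) a b →
      ∃ r ∈ Icc 0 δ, ⟪dirOracle f g F G x (linePt δ x ζ r) (unitVec ζ), unitVec ζ⟫_ℝ < ε / 2 ∧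
        Reach f g F G δ ε dir (1 + j) (.test x ζ a b) (BState.settle f g δ ε x
          (minNormSeg ζ (dirOracle f g F G x (linePt δ x ζ r) (unitVec ζ)))) := by
  induction j with
  | zero =>
    intro k hk a b h
    have hstep := Reach.step (f := f) (g := g) (F := F) (G := G) (δ := δ) (ε := ε) (dir := dir)
        (.test x ζ a b)
    simp only [BState.step, BState.cost] at hstep
    split_ifs at hstep with hh
    · exact ⟨a, ⟨h.nonneg, h.lt.le.trans h.le⟩, by linarith, hstep⟩
    · have h1 := h.le_two_mul (rightNonneg_lineFun hF hG hh) hc.conv_add hc.lip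
      rw [← le_div_iff₀ (by positivity)] at h1
      have h2 := h1.trans_lt hc.bound
      rw [← hk] at h2
      simp at h2
  | succ j ih =>
    intro k hk a b h
    have hstep := Reach.step (f := f) (g := g) (F := F) (G := G) (δ := δ) (ε := ε) (dir := dir)
        (.test x ζ a b)
    simp only [BState.step, BState.cost] at hstep
    split_ifs at hstep with hh
    · exact ⟨a, ⟨h.nonneg, h.lt.le.trans h.le⟩, by linarith, hstep.mono (by omega)⟩
    · obtain ⟨a', b', h1, h2⟩ := reach_halve (F := F) (G := G) (dir := dir) x ζ
        (rightNonneg_lineFun hF hG hh) (by positivity) hc.conv hc.conv_add h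
      obtain ⟨r, hr, hr1, hr2⟩ := ih (k + 1) (by omega) a' b' (by
        have : ((k : ℝ) + 1) * (ε / 6) + ε / 6 = (((k + 1 : ℕ) : ℝ) + 1) * (ε / 6) := by
          push_cast; ring
        rwa [this] at h1)
      exact ⟨r, hr, hr1, (hstep.trans (h2.trans hr2)).mono (by omega)⟩

/-- A bisection started in the `while` loop satisfies the invariant. -/
theorem bisectInv_start (hδ : 0 < δ) {K : ℝ} {x ζ : E n} {s : ℝ → ℝ}
    (hs : ∀ u ∈ Icc 0 δ, ∀ v ∈ Icc 0 δ, |s u - s v| ≤ K * |u - v|)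
    (h : hFun f g x x - hFun f g x (move δ x ζ) < δ * ε / 3) :
    BisectInv (lineFun f g δ ε x ζ) s δ K (ε / 6) ((((0 : ℕ) : ℝ) + 1) * (ε / 6)) 0 δ := by
  have h1 : (lineFun f g δ ε x ζ δ - lineFun f g δ ε x ζ 0) / (δ - 0) < -(ε / 6) := by
    rw [sub_zero, div_lt_iff₀ hδ]
    simp only [lineFun, linePt_right, linePt_zero]
    linarith
  refine ⟨le_rfl, hδ, le_rfl, h1, fun t ht => ?_⟩
  have h2 : -K ≤ (s t - s 0) / (t - 0) := by
    rw [sub_zero, le_div_iff₀ ht.1]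
    have := hs t ⟨ht.1.le, ht.2⟩ 0 ⟨le_rfl, hδ.le⟩
    rw [sub_zero, abs_of_pos ht.1] at this
    linarith [(abs_le.1 this).1]
  push_cast
  linarith

/-- The oracle vectors available to the subroutine at `x`. -/
def dirValues (f g : E n → ℝ) (F G : E n → E n → E n) (δ : ℝ) (x : E n) : Set (E n) :=
  {w | ∃ z ∈ Metric.closedBall x δ, ∃ v, w = dirOracle f g F G x z v}

/-- One call of the subroutine from inside its loop: it needs at most `r` further passes through
the loop if `4 M² / ε² < 4 M² / ‖ζ‖² + r`. -/
theorem reach_settle {S : Set (E n)} {M p K : ℝ} {L : ℕ} (hL : IsLocalModel f g S M δ p)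
    (hM : 0 < M)
    (hδ : 0 < δ) (hε : 0 < ε) (hF : IsDirOracle f F) (hG : IsDirOracle g G)
    (hbd : ∀ x ∈ S, ∀ w ∈ dirValues f g F G δ x, ‖w‖ ≤ M)
    (hcv : ∀ x ζ, ζ ≠ 0 → ∃ s, IsConvexifier f g δ ε K L x ζ s) {x : E n} (hx : x ∈ S) (r : ℕ) :
    ∀ ζ ∈ convexHull ℝ (dirValues f g F G δ x), ‖ζ‖ ≤ M →
      (ζ ≠ 0 → 4 * M ^ 2 / ε ^ 2 < 4 * M ^ 2 / ‖ζ‖ ^ 2 + r) →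
      ∃ s', Reach f g F G δ ε dir (r * (1 + L)) (BState.settle f g δ ε x ζ) s' ∧
        ((s' = .done x ∧ ∃ ξ ∈ convexHull ℝ (dirValues f g F G δ x), ‖ξ‖ ≤ ε) ∨
          ∃ y ∈ S, f y ≤ f x - δ * ε / 3 ∧ s' = .call y) := by
  induction r with
  | zero =>
    intro ζ hζ hζM hr
    have hle : ‖ζ‖ ≤ ε := by
      by_contra! hlt
      have hζ0 : ζ ≠ 0 := norm_pos_iff.1 (hε.trans hlt)
      have h1 := hr hζ0
      have h2 : 4 * M ^ 2 / ‖ζ‖ ^ 2 ≤ 4 * M ^ 2 / ε ^ 2 := by gcongr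
      rw [Nat.cast_zero, add_zero] at h1
      linarith
    refine ⟨_, Reach.refl _ _, .inl ⟨?_, ζ, hζ, hle⟩⟩
    rw [BState.settle, if_neg (fun h => not_lt.2 hle h.1), if_pos hle]
  | succ r ih =>
    intro ζ hζ hζM hr
    rcases le_or_gt ‖ζ‖ ε with hle | hlt
    · refine ⟨_, Reach.refl _ _, .inl ⟨?_, ζ, hζ, hle⟩⟩
      rw [BState.settle, if_neg (fun h => not_lt.2 hle h.1), if_pos hle]
    have hζ0 : ζ ≠ 0 := norm_pos_iff.1 (hε.trans hlt)
    rcases lt_or_ge (hFun f g x x - hFun f g x (move δ x ζ)) (δ * ε / 3) with hd | hd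
    swap
    · obtain ⟨h1, h2⟩ := hL.descent hx (move_mem_closedBall hδ.le x ζ) (by positivity) hd
      refine ⟨_, Reach.refl _ _, .inr ⟨_, h1, h2, ?_⟩⟩
      rw [BState.settle, if_neg (fun h => not_lt.2 hd h.2), if_neg (not_le.2 hlt)]
    obtain ⟨s, hs⟩ := hcv x ζ hζ0
    obtain ⟨a, ha, ha1, ha2⟩ := reach_test (dir := dir) hF hG hε hs L 0 (zero_add L) 0 δ
      (bisectInv_start hδ hs.lip hd)
    set w := dirOracle f g F G x (linePt δ x ζ a) (unitVec ζ) with hw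
    have hwmem : w ∈ dirValues f g F G δ x := ⟨_, linePt_mem_closedBall x hζ0 ha, _, rfl⟩
    have hin : ⟪w, ζ⟫_ℝ ≤ ‖ζ‖ ^ 2 / 2 := by
      have h1 : ζ = ‖ζ‖ • unitVec ζ := by
        rw [unitVec, smul_smul, mul_one_div, div_self (norm_ne_zero_iff.2 hζ0), one_smul]
      have h2 : ⟪w, ζ⟫_ℝ = ‖ζ‖ * ⟪w, unitVec ζ⟫_ℝ := by
        conv_lhs => rw [h1]
        rw [inner_smul_right]
      rw [h2]
      nlinarith [norm_nonneg ζ]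
    have hseg : minNormSeg ζ w ∈ convexHull ℝ (dirValues f g F G δ x) :=
      (convex_convexHull ℝ _).segment_subset hζ (subset_convexHull _ _ hwmem) (minNormSeg_mem ζ w)
    obtain ⟨s', h1, h2⟩ := ih (minNormSeg ζ w) hseg ((norm_minNormSeg_le_left _ _).trans hζM)
      (fun h0 => by
        have h3 := add_one_le_div_norm_minNormSeg_sq hM hζM (hbd x hx w hwmem) hin h0 hζ0
        have h4 := hr hζ0
        push_cast at h4
        linarith)
    refine ⟨s', ?_, h2⟩
    rw [BState.settle, if_pos ⟨hlt, hd⟩]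
    exact (ha2.trans h1).mono (le_of_eq (by ring))

/-- Iterating over the outer method: `k + 1` calls suffice if fewer than `k + 1` decreases
by `δ ε / 3` are possible. -/
theorem reach_done {S : Set (E n)} {M p K : ℝ} {L : ℕ} (hL : IsLocalModel f g S M δ p)
    (hM : 0 < M)
    (hδ : 0 < δ) (hε : 0 < ε) (hF : IsDirOracle f F) (hG : IsDirOracle g G)
    (hbd : ∀ x ∈ S, ∀ w ∈ dirValues f g F G δ x, ‖w‖ ≤ M)
    (hcv : ∀ x ζ, ζ ≠ 0 → ∃ s, IsConvexifier f g δ ε K L x ζ s) {r : ℕ}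
    (hr : 4 * M ^ 2 / ε ^ 2 < 4 + r) (k : ℕ) :
    ∀ x ∈ S, f x - p < (k + 1) * (δ * ε / 3) →
      ∃ y ∈ S, (∃ ξ ∈ convexHull ℝ (dirValues f g F G δ y), ‖ξ‖ ≤ ε) ∧
        Reach f g F G δ ε dir ((k + 1) * ((1 + r) * (1 + L))) (.call x) (.done y) := by
  have hcall : ∀ x ∈ S, ∃ s', Reach f g F G δ ε dir ((1 + r) * (1 + L)) (.call x) s' ∧
        ((s' = .done x ∧ ∃ ξ ∈ convexHull ℝ (dirValues f g F G δ x), ‖ξ‖ ≤ ε) ∨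
          ∃ y ∈ S, f y ≤ f x - δ * ε / 3 ∧ s' = .call y) := by
    intro x hx
    have hmem : dirOracle f g F G x x (dir x) ∈ dirValues f g F G δ x :=
      ⟨x, Metric.mem_closedBall_self hδ.le, _, rfl⟩
    have hnorm := hbd x hx _ hmem
    obtain ⟨s', h1, h2⟩ := reach_settle (dir := dir) hL hM hδ hε hF hG hbd hcv hx r _
      (subset_convexHull _ _ hmem) hnorm (fun h0 => hr.trans_le (by
        gcongr
        rw [le_div_iff₀ (by positivity)]
        gcongr))
    have hstep := Reach.step (f := f) (g := g) (F := F) (G := G) (δ := δ) (ε := ε) (dir := dir)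
        (.call x)
    refine ⟨s', (hstep.trans h1).mono ?_, h2⟩
    simp only [BState.cost]
    nlinarith [Nat.zero_le L]
  induction k with
  | zero =>
    intro x hx hk
    obtain ⟨s', h1, ⟨rfl, h2⟩ | ⟨y, hy, h2, -⟩⟩ := hcall x hx
    · exact ⟨x, hx, h2, by simpa using h1⟩
    · push_cast at hk
      linarith [hL.bound y hy]
  | succ k ih =>
    intro x hx hk
    obtain ⟨s', h1, ⟨rfl, h2⟩ | ⟨y, hy, h2, rfl⟩⟩ := hcall x hx
    · exact ⟨x, hx, h2, h1.mono (Nat.le_mul_of_pos_left _ (by omega))⟩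
    · obtain ⟨z, hz, hz1, hz2⟩ := ih y hy (by push_cast at hk; linarith)
      exact ⟨z, hz, hz1, (h1.trans hz2).mono (le_of_eq (by ring))⟩

/-- The total bound. One pass through the loop raises `4 M² / ‖ζ‖²` by one, so that a
call costs about a quarter of `⌈16 M² / ε²⌉` passes; this leaves room for the final call, which
the factor `⌈3 (f(x₀) - p) / (δ ε)⌉` does not count if the quotient is an integer. -/
theorem exists_reach_done {S : Set (E n)} {M p K : ℝ} {L : ℕ} (hL : IsLocalModel f g S M δ p)
    (hM : 0 < M) (hδ : 0 < δ) (hε : 0 < ε) (hF : IsDirOracle f F) (hG : IsDirOracle g G)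
    (hbd : ∀ x ∈ S, ∀ w ∈ dirValues f g F G δ x, ‖w‖ ≤ M)
    (hcv : ∀ x ζ, ζ ≠ 0 → ∃ s, IsConvexifier f g δ ε K L x ζ s) {x : E n} (hx : x ∈ S) :
    ∃ y ∈ S, (∃ ξ ∈ convexHull ℝ (dirValues f g F G δ y), ‖ξ‖ ≤ ε) ∧
      Reach f g F G δ ε dir (⌈max 1 (3 * (f x - p) / (δ * ε))⌉₊ * ⌈16 * M ^ 2 / ε ^ 2⌉₊ * (1 + L))
        (.call x) (.done y) := by
  set N := ⌈max 1 (3 * (f x - p) / (δ * ε))⌉₊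
  set B := ⌈16 * M ^ 2 / ε ^ 2⌉₊ with hB
  have hN : max 1 (3 * (f x - p) / (δ * ε)) ≤ N := Nat.le_ceil _
  have hN1 : 1 ≤ N := by exact_mod_cast (le_max_left _ _).trans hN
  have hB1 : 1 ≤ B := Nat.one_le_ceil_iff.2 (by positivity)
  rcases le_or_gt M ε with hMε | hMε
  -- If `M ≤ ε`, the first oracle vector is already short enough.
  · have hmem : dirOracle f g F G x x (dir x) ∈ dirValues f g F G δ x :=
      ⟨x, Metric.mem_closedBall_self hδ.le, _, rfl⟩
    have hle := (hbd x hx _ hmem).trans hMε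
    have hstep := Reach.step (f := f) (g := g) (F := F) (G := G) (δ := δ) (ε := ε) (dir := dir)
        (.call x)
    simp only [BState.step, BState.cost] at hstep
    rw [BState.settle, if_neg (fun h => not_lt.2 hle h.1), if_pos hle] at hstep
    refine ⟨x, hx, ⟨_, subset_convexHull _ _ hmem, hle⟩, hstep.mono ?_⟩
    exact Nat.one_le_iff_ne_zero.2 (by positivity)
  · set Y := 4 * M ^ 2 / ε ^ 2 with hY
    have hY4 : 4 ≤ Y := by rw [hY, le_div_iff₀ (by positivity)]; gcongr
    have hYB : 4 * Y ≤ B := by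
      refine le_trans (le_of_eq ?_) (Nat.le_ceil _)
      rw [hY]; ring
    have hfl : 4 ≤ ⌊Y⌋₊ := Nat.le_floor (by exact_mod_cast hY4)
    have hfl2 : (⌊Y⌋₊ : ℝ) ≤ Y := Nat.floor_le (by linarith)
    obtain ⟨r, hr⟩ : ∃ r, ⌊Y⌋₊ = r + 3 := ⟨⌊Y⌋₊ - 3, by omega⟩
    have hrY : Y < 4 + r := by
      have := Nat.lt_floor_add_one Y
      rw [hr] at this; push_cast at this; linarith
    have hNx : f x - p < (N + 1) * (δ * ε / 3) := by
      have h1 := (le_max_right 1 _).trans hN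
      rw [div_le_iff₀ (by positivity)] at h1
      have : 0 < δ * ε := by positivity
      linarith
    obtain ⟨y, hy, h1, h2⟩ := reach_done (dir := dir) hL hM hδ hε hF hG hbd hcv hrY N x hx hNx
    refine ⟨y, hy, h1, h2.mono ?_⟩
    have h3 : 2 * (1 + r) ≤ B := by
      have : (2 * (1 + r) : ℝ) ≤ B := by
        rw [hr] at hfl2; push_cast at hfl2; linarith
      exact_mod_cast this
    calc (N + 1) * ((1 + r) * (1 + L)) ≤ (2 * N) * ((1 + r) * (1 + L)) := by gcongr; omega
      _ = N * (2 * (1 + r)) * (1 + L) := by ring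
      _ ≤ N * B * (1 + L) := by gcongr

/-- Lipschitz constants for convexifiers slightly above the moduli give the same number of
bisection steps as the moduli themselves. -/
theorem exists_lipschitz_constants {a b : ℝ≥0∞} (ha : a ≠ ∞) (hb : b ≠ ∞) {ε : ℝ} (hε : 0 < ε) :
    ∃ K₁ K₂ : ℝ≥0, a < K₁ ∧ b < K₂ ∧
      2 * ((K₁ : ℝ) + K₂) / (ε / 6) < ⌊12 * (a.toReal + b.toReal) / ε⌋₊ + 1 := by
  lift a to ℝ≥0 using ha
  lift b to ℝ≥0 using hb
  simp only [ENNReal.coe_toReal]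
  set y := 12 * ((a : ℝ) + b) / ε with hy
  have h1 : y < ⌊y⌋₊ + 1 := Nat.lt_floor_add_one y
  obtain ⟨κ, hκ⟩ : ∃ κ : ℝ≥0, (κ : ℝ) = (⌊y⌋₊ + 1 - y) * ε / 48 :=
    ⟨⟨(⌊y⌋₊ + 1 - y) * ε / 48, by have := sub_pos.2 h1; positivity⟩, rfl⟩
  have hκ0 : 0 < κ := by
    have : (0 : ℝ) < κ := by rw [hκ]; have := sub_pos.2 h1; positivity
    exact_mod_cast this
  refine ⟨a + κ, b + κ, by exact_mod_cast lt_add_of_pos_right a hκ0,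
    by exact_mod_cast lt_add_of_pos_right b hκ0, ?_⟩
  have h2 : 2 * (((a + κ : ℝ≥0) : ℝ) + ((b + κ : ℝ≥0) : ℝ)) / (ε / 6) =
      y + (⌊y⌋₊ + 1 - y) / 2 := by
    push_cast
    rw [hκ, hy]
    field_simp
    ring
  rw [h2]
  linarith

theorem exists_bisecState_eq_done {D : Subdiff n} {M p σ ε' : ℝ}
    (hL : IsLocalModel f g (feasible g) M δ p) (hM : 0 < M) (hδ : 0 < δ) (hε' : 0 < ε')
    (hσ : 0 < σ) (hε : ε = σ * ε' / (ε' + σ + M))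
    (hQ : ∀ x ∈ feasible g, GCQ D (fun _ : Unit => g) δ σ (2 * M * δ) x)
    (hF : IsDirOracle f F) (hG : IsDirOracle g G)
    (hO : ∀ x ∈ feasible g, ∀ z ∈ Metric.closedBall x δ, ∀ v,
      F z v ∈ D f z ∧ G z v ∈ D g z ∧ ‖F z v‖ ≤ M ∧ ‖G z v‖ ≤ M)
    (hf : nonconvexityModulus f δ ≠ ∞) (hg : nonconvexityModulus g δ ≠ ∞) {x₀ : E n}
    (hx₀ : g x₀ ≤ 0) :
    ∃ (T : ℕ) (x : E n), bisecState f g F G δ ε dir x₀ T = .done x ∧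
      IsGKKT D f (fun _ : Unit => g) δ ε' (3 * M * δ * (ε' + σ + M) / σ) x ∧
      ∑ j ∈ Finset.range T, (bisecState f g F G δ ε dir x₀ j).cost ≤
        ⌈max 1 (3 * (f x₀ - p) / (δ * ε))⌉₊ * ⌈16 * M ^ 2 / ε ^ 2⌉₊ *
          (1 + ⌊12 * ((nonconvexityModulus f δ).toReal + (nonconvexityModulus g δ).toReal) / ε⌋₊)
      := by
  have hεp : 0 < ε := by rw [hε]; positivity
  obtain ⟨K₁, K₂, h1, h2, h3⟩ := exists_lipschitz_constants hf hg hεp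
  have hbd : ∀ x ∈ feasible g, ∀ w ∈ dirValues f g F G δ x, ‖w‖ ≤ M := by
    rintro x hx w ⟨z, hz, v, rfl⟩
    unfold dirOracle
    split_ifs
    exacts [(hO x hx z hz v).2.2.1, (hO x hx z hz v).2.2.2]
  obtain ⟨y, hy, ⟨ξ, hξ, hξε⟩, T, hT, hcost⟩ := exists_reach_done (dir := dir) (K := K₁ + K₂) hL hM
    hδ hεp hF hG hbd (fun x ζ hζ => by
      obtain ⟨s, hs1, hs2, hs3⟩ := exists_convexOn_lineFun_add hδ h1 h2 ε x hζ
      refine ⟨s, hs1, fun u hu v hv => ?_, hs3, h3⟩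
      simpa [Real.dist_eq] using hs2.dist_le_mul u hu v hv) (show x₀ ∈ feasible g from hx₀)
  refine ⟨T, y, hT, ?_, hcost⟩
  have hyb : y ∈ Metric.closedBall y δ := Metric.mem_closedBall_self hδ.le
  refine isGKKT_of_mem_convexHull hL hM.le hδ hε' hσ hy (hQ y hy) ?_ ?_ (hε ▸ hξε)
  · exact ⟨G y 0, subset_convexHull _ _ (mem_iUnion₂.2 ⟨y, hyb, (hO y hy y hyb 0).2.1⟩)⟩
  · refine convexHull_mono ?_ hξ
    rintro w ⟨z, hz, v, rfl⟩
    obtain ⟨h4, h5, h6, h7⟩ := hO y hy z hz v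
    unfold dirOracle
    split_ifs with h
    · exact .inl ⟨z, hz, h4, h6⟩
    · exact .inr ⟨z, hz, h5, not_lt.1 fun h' => h (.inl h')⟩

end Deterministic

/-! ### Null sets along random segments -/

theorem ae_comp_add_smul {V : Type*} [NormedAddCommGroup V] [NormedSpace ℝ V] [MeasurableSpace V]
    [BorelSpace V] [FiniteDimensional ℝ V] (μ : Measure V) [μ.IsAddHaarMeasure] {P : V → Prop}
    (h : ∀ᵐ y ∂μ, P y) (a : V) {c : ℝ} (hc : c ≠ 0) : ∀ᵐ y ∂μ, P (a + c • y) := by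
  rw [ae_iff] at h ⊢
  have h1 : {y | ¬ P (a + c • y)} = (fun y => c • y) ⁻¹' ((fun y => a + y) ⁻¹' {y | ¬ P y}) := rfl
  rw [h1, Measure.addHaar_preimage_smul μ hc, measure_preimage_add, h, mul_zero]

/-- For almost every direction `y`, almost every point of the segment from `x` along `y` avoids
a given null set. By Fubini `t • y` avoids a null set for almost every `(y, t)`, and for fixed
`y` the parameter `t` can be rescaled by `δ / ‖y‖`. -/
theorem ae_ae_move_notMem {Z : Set (E n)} (hZm : MeasurableSet Z)
    (hZ : (volume : Measure (E n)) Z = 0) {δ : ℝ} (hδ : 0 < δ) (x : E n) :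
    ∀ᵐ y : E n, ∀ᵐ t : ℝ, y ≠ 0 → move (t * δ) x y ∉ Z := by
  have hmeas : MeasurableSet {p : E n × ℝ | x + (-p.2) • p.1 ∉ Z} := by
    refine (measurableSet_preimage ?_ hZm).compl
    fun_prop
  have h1 : ∀ᵐ t : ℝ, ∀ᵐ y : E n, x + (-t) • y ∉ Z := by
    have h0 : ∀ᵐ t : ℝ, t ≠ 0 := by simp [ae_iff]
    filter_upwards [h0] with t ht
    have h2 : ∀ᵐ y : E n, y ∉ Z := by simpa [ae_iff] using hZ
    exact ae_comp_add_smul volume h2 x (neg_ne_zero.2 ht)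
  have h2 := (Measure.ae_ae_comm (p := fun (y : E n) (t : ℝ) => x + (-t) • y ∉ Z) hmeas).2 h1
  filter_upwards [h2] with y hy
  rcases eq_or_ne y 0 with rfl | hy0
  · exact .of_forall fun _ h => absurd rfl h
  have h3 := ae_comp_add_smul volume hy 0 (c := δ / ‖y‖) (by positivity)
  filter_upwards [h3] with t ht _
  rw [move, sub_eq_add_neg, ← neg_smul, show -(t * δ / ‖y‖) = -(0 + (δ / ‖y‖) • t) by
    rw [smul_eq_mul, zero_add]; ring]
  exact ht

/-! ### The average slope along a random direction -/

theorem norm_gradient_le {f : E n → ℝ} {M : ℝ≥0} (hf : LipschitzWith M f) {z w : E n}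
    (h : HasGradientAt f w z) : ‖w‖ ≤ M := by
  have := h.hasFDerivAt.le_of_lipschitz hf
  simpa using this

theorem lipschitzWith_hFun {f g : E n → ℝ} {M : ℝ≥0} (hf : LipschitzWith M f)
    (hg : LipschitzWith M g) (x : E n) : LipschitzWith M (hFun f g x) := by
  change LipschitzWith M fun z => max (f z - f x) (g z)
  simpa using (hf.sub (LipschitzWith.const (f x))).max hg

/-- The fundamental theorem of calculus for the Lipschitz function `h_x` on a segment. Where `h_x`
is differentiable along the segment, its derivative is that of the function selected by
the oracle, since this function lies below `h_x` and agrees with it at the point. -/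
theorem integral_inner_gradOracle {f g : E n → ℝ} {M : ℝ≥0} (hf : LipschitzWith M f)
    (hg : LipschitzWith M g) {Gf Gg : E n → E n} {δ : ℝ} (hδ : 0 < δ) (x e : E n)
    (hgrad : ∀ᵐ v : ℝ, v ∈ Icc (0 : ℝ) 1 →
      HasGradientAt f (Gf (x - (v * δ) • e)) (x - (v * δ) • e) ∧
      HasGradientAt g (Gg (x - (v * δ) • e)) (x - (v * δ) • e)) :
    ∫ v in (0 : ℝ)..1, ⟪gradOracle f g Gf Gg x (x - (v * δ) • e), e⟫_ℝ =
      (hFun f g x x - hFun f g x (x - δ • e)) / δ := by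
  set z : ℝ → E n := fun v => x - (v * δ) • e with hz
  have hline : ∀ v, HasDerivAt z (-(δ • e)) v := by
    intro v
    have h1 : HasDerivAt (fun v : ℝ => (v * δ) • e) ((1 * δ) • e) v :=
      ((hasDerivAt_id v).mul_const δ).smul_const e
    simpa using (h1.const_sub x)
  have hzL : LipschitzWith (‖δ • e‖₊) z := by
    refine LipschitzWith.of_dist_le_mul fun a b => le_of_eq ?_
    have : z a - z b = (b - a) • (δ • e) := by simp only [hz]; module
    rw [dist_eq_norm, this, norm_smul, Real.dist_eq, coe_nnnorm, mul_comm, Real.norm_eq_abs,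
      abs_sub_comm]
  have hhL := lipschitzWith_hFun hf hg x
  have hφ : LipschitzWith (M * ‖δ • e‖₊) (fun v => hFun f g x (z v)) := hhL.comp hzL
  have hFTC :=
    (hφ.lipschitzOnWith (s := uIcc 0 1)).absolutelyContinuousOnInterval.integral_deriv_eq_sub
  have hae : ∀ᵐ v : ℝ, v ∈ Set.uIoc (0 : ℝ) 1 →
      ⟪gradOracle f g Gf Gg x (z v), e⟫_ℝ = -δ⁻¹ * deriv (fun v => hFun f g x (z v)) v := by
    filter_upwards [hgrad, hφ.ae_differentiableAt_real] with v hv hd hv01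
    rw [uIoc_of_le zero_le_one] at hv01
    obtain ⟨h1, h2⟩ := hv ⟨hv01.1.le, hv01.2⟩
    have key : ∀ (k : E n → ℝ) (w : E n), HasGradientAt k w (z v) →
        (∀ y, k y ≤ hFun f g x y) → k (z v) = hFun f g x (z v) →
        ⟪w, e⟫_ℝ = -δ⁻¹ * deriv (fun v => hFun f g x (z v)) v := by
      intro k w hk hle heq
      have h3 := hk.hasFDerivAt.comp_hasDerivAt v (hline v)
      simp only [InnerProductSpace.toDual_apply_apply] at h3
      have h4 : IsLocalMin (fun v => hFun f g x (z v) - k (z v)) v := by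
        refine .of_forall fun t => ?_
        have := hle (z t)
        simp only [heq, sub_self]
        linarith
      have h5 := h4.hasDerivAt_eq_zero (hd.hasDerivAt.sub h3)
      rw [inner_neg_right, inner_smul_right] at h5
      rw [show deriv (fun v => hFun f g x (z v)) v = -(δ * ⟪w, e⟫_ℝ) by linarith]
      field_simp
    unfold gradOracle
    split_ifs with hc
    · refine key (fun y => f y - f x) _ ?_ (fun y => le_max_left _ _) (max_eq_left hc).symm
      have := h1.hasFDerivAt.sub_const (f x)
      exact hasGradientAt_iff_hasFDerivAt.2 this
    · exact key g _ h2 (fun y => le_max_right _ _) (max_eq_right (not_le.1 hc).le).symm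
  rw [intervalIntegral.integral_congr_ae hae, intervalIntegral.integral_const_mul, hFTC]
  simp only [hz, zero_mul, zero_smul, sub_zero, one_mul]
  ring

/-- A vector `y` in a ball of the admissible radius around `ζ` is nonzero, and its direction is
`‖ζ‖ / (8 M)`-close to that of `ζ`. -/
theorem norm_unitVec_sub_le {M r : ℝ} (hM : 0 < M) {ζ y : E n} (hζ : ζ ≠ 0) (hζM : ‖ζ‖ ≤ M)
    (hr : r < ‖ζ‖ * √(1 - (1 - ‖ζ‖ ^ 2 / (128 * M ^ 2)) ^ 2)) (hy : ‖y - ζ‖ ≤ r) :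
    y ≠ 0 ∧ ‖unitVec y - unitVec ζ‖ ≤ ‖ζ‖ / (8 * M) := by
  obtain ⟨a, ha⟩ : ∃ a, a = 1 - ‖ζ‖ ^ 2 / (128 * M ^ 2) := ⟨_, rfl⟩
  rw [← ha] at hr
  have hζ0 : 0 < ‖ζ‖ := norm_pos_iff.2 hζ
  have hq : ‖ζ‖ ^ 2 ≤ M ^ 2 := by gcongr
  have ha0 : 0 < a := by
    have : ‖ζ‖ ^ 2 / (128 * M ^ 2) < 1 := by
      rw [div_lt_one (by positivity)]; nlinarith [pow_pos hM 2]
    linarith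
  have ha1 : a ≤ 1 := by
    have : 0 ≤ ‖ζ‖ ^ 2 / (128 * M ^ 2) := by positivity
    linarith
  have h1 : ‖y - ζ‖ ^ 2 < ‖ζ‖ ^ 2 * (1 - a ^ 2) := by
    have h2 : ‖y - ζ‖ ^ 2 < (‖ζ‖ * √(1 - a ^ 2)) ^ 2 := by
      have := hy.trans_lt hr
      gcongr
    rwa [mul_pow, Real.sq_sqrt (by nlinarith)] at h2
  rw [norm_sub_sq_real] at h1
  have h3 : 0 < ⟪y, ζ⟫_ℝ := by nlinarith [mul_pos (pow_pos hζ0 2) (pow_pos ha0 2), sq_nonneg ‖y‖]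
  have hy0 : y ≠ 0 := by rintro rfl; simp at h3
  have hyn : 0 < ‖y‖ := norm_pos_iff.2 hy0
  have h4 : ‖y‖ * ‖ζ‖ * a ≤ ⟪y, ζ⟫_ℝ := by nlinarith [sq_nonneg (‖y‖ - ‖ζ‖ * a)]
  refine ⟨hy0, ?_⟩
  have h5 : ‖unitVec y - unitVec ζ‖ ^ 2 ≤ (‖ζ‖ / (8 * M)) ^ 2 := by
    rw [norm_sub_sq_real, norm_unitVec hy0, norm_unitVec hζ, unitVec, unitVec, inner_smul_left,
      inner_smul_right]
    simp only [conj_trivial]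
    have h6 : a ≤ 1 / ‖y‖ * (1 / ‖ζ‖ * ⟪y, ζ⟫_ℝ) := by
      rw [← mul_assoc, div_mul_div_comm, one_mul, one_div_mul_eq_div, le_div_iff₀ (by positivity)]
      linarith
    have h7 : (‖ζ‖ / (8 * M)) ^ 2 = 2 * (1 - a) := by rw [ha]; field_simp; ring
    rw [h7]
    linarith
  exact (sq_le_sq₀ (norm_nonneg _) (by positivity)).1 h5

theorem move_eq_sub_smul_unitVec (t : ℝ) (x y : E n) : move t x y = x - t • unitVec y := by
  rw [move, unitVec, smul_smul, mul_one_div]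

/-- The expected inner product of the oracle vector with `ζ`, for a fixed perturbed
direction `y`, is at most `‖ζ‖² / 2`: the step in direction `ζ` decreases `h_x` by little, and
replacing `ζ` by `y` costs at most `M ‖ζ‖ / (8 M)` twice. -/
theorem integral_inner_gradOracle_le {f g : E n → ℝ} {M : ℝ≥0} (hM : 0 < M)
    (hf : LipschitzWith M f) (hg : LipschitzWith M g) {Gf Gg : E n → E n} (hGf : Measurable Gf)
    (hGg : Measurable Gg) {δ r : ℝ} (hδ : 0 < δ) (x : E n) {ζ y : E n} (hζ : ζ ≠ 0)
    (hζM : ‖ζ‖ ≤ M) (hr : r < ‖ζ‖ * √(1 - (1 - ‖ζ‖ ^ 2 / (128 * (M : ℝ) ^ 2)) ^ 2))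
    (hy : ‖y - ζ‖ ≤ r) (hd : hFun f g x x - hFun f g x (move δ x ζ) ≤ δ * ‖ζ‖ / 4)
    (hgrad : ∀ᵐ v : ℝ, v ∈ Icc (0 : ℝ) 1 →
      HasGradientAt f (Gf (move (v * δ) x y)) (move (v * δ) x y) ∧
      HasGradientAt g (Gg (move (v * δ) x y)) (move (v * δ) x y)) :
    ∫ v in Icc (0 : ℝ) 1, ⟪gradOracle f g Gf Gg x (move (v * δ) x y), ζ⟫_ℝ ≤ ‖ζ‖ ^ 2 / 2 := by
  have hMr : (0 : ℝ) < M := hM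
  obtain ⟨hy0, hang⟩ := norm_unitVec_sub_le hMr hζ hζM hr hy
  have hζ0 : 0 < ‖ζ‖ := norm_pos_iff.2 hζ
  simp only [move_eq_sub_smul_unitVec] at hgrad hd ⊢
  have hFTC := integral_inner_gradOracle hf hg hδ x (unitVec y) hgrad
  set w : ℝ → E n := fun v => gradOracle f g Gf Gg x (x - (v * δ) • unitVec y) with hw
  have hwm : Measurable w := by
    have hz : Measurable fun v : ℝ => x - (v * δ) • unitVec y := by fun_prop
    refine Measurable.ite ?_ (hGf.comp hz) (hGg.comp hz)
    exact measurableSet_le (hg.continuous.measurable.comp hz)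
      ((hf.continuous.measurable.comp hz).sub_const _)
  have hwM : ∀ᵐ v : ℝ ∂volume.restrict (Icc (0 : ℝ) 1), ‖w v‖ ≤ M := by
    rw [ae_restrict_iff' measurableSet_Icc]
    filter_upwards [hgrad] with v hv hv01
    simp only [hw, gradOracle]
    split_ifs
    exacts [norm_gradient_le hf (hv hv01).1, norm_gradient_le hg (hv hv01).2]
  have hint : ∀ a : E n, IntegrableOn (fun v => ⟪w v, a⟫_ℝ) (Icc (0 : ℝ) 1) := by
    intro a
    refine Integrable.of_bound (C := M * ‖a‖) (hwm.inner measurable_const).aestronglyMeasurable ?_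
    filter_upwards [hwM] with v hv
    exact (norm_inner_le_norm _ _).trans (by gcongr)
  have hle : ∫ v in Icc (0 : ℝ) 1, ⟪w v, ζ⟫_ℝ ≤
      ∫ v in Icc (0 : ℝ) 1, ‖ζ‖ * (⟪w v, unitVec y⟫_ℝ + ‖ζ‖ / 8) := by
    refine integral_mono_ae (hint ζ) (((hint _).add (integrable_const _)).const_mul _) ?_
    filter_upwards [hwM] with v hv
    have h1 : ⟪w v, ζ⟫_ℝ = ‖ζ‖ * ⟪w v, unitVec ζ⟫_ℝ := by
      rw [← inner_smul_right, unitVec, smul_smul, mul_one_div, div_self hζ0.ne', one_smul]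
    have h2 : ⟪w v, unitVec ζ⟫_ℝ = ⟪w v, unitVec y⟫_ℝ - ⟪w v, unitVec y - unitVec ζ⟫_ℝ := by
      rw [inner_sub_right]; ring
    have h3 : |⟪w v, unitVec y - unitVec ζ⟫_ℝ| ≤ ‖ζ‖ / 8 := by
      calc _ ≤ ‖w v‖ * ‖unitVec y - unitVec ζ‖ := abs_real_inner_le_norm _ _
        _ ≤ M * (‖ζ‖ / (8 * M)) := by gcongr
        _ = ‖ζ‖ / 8 := by field_simp
    simp only [h1, h2]
    gcongr
    linarith [(abs_le.1 h3).1]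
  refine hle.trans ?_
  rw [integral_const_mul, integral_add (hint _) (integrable_const _),
    integral_Icc_eq_integral_Ioc, ← intervalIntegral.integral_of_le zero_le_one, hFTC]
  have hlip : hFun f g x (x - δ • unitVec ζ) - hFun f g x (x - δ • unitVec y) ≤ δ * ‖ζ‖ / 8 := by
    have h2 := (lipschitzWith_hFun hf hg x).dist_le_mul (x - δ • unitVec ζ) (x - δ • unitVec y)
    have h3 : x - δ • unitVec ζ - (x - δ • unitVec y) = δ • (unitVec y - unitVec ζ) := by module
    rw [dist_eq_norm, dist_eq_norm, h3, norm_smul, Real.norm_of_nonneg hδ.le] at h2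
    calc _ ≤ _ := le_abs_self _
      _ ≤ _ := h2
      _ ≤ M * (δ * (‖ζ‖ / (8 * M))) := by gcongr
      _ = δ * ‖ζ‖ / 8 := by field_simp
  have hfin : (hFun f g x x - hFun f g x (x - δ • unitVec y)) / δ ≤ ‖ζ‖ / 4 + ‖ζ‖ / 8 := by
    rw [div_le_iff₀ hδ]; linarith
  simp only [integral_const, MeasurableSet.univ, measureReal_restrict_apply, univ_inter,
    Real.volume_real_Icc, sub_zero, zero_le_one, max_eq_left, smul_eq_mul, one_mul]
  nlinarith

/-! ### Measurability of the randomized method -/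

section Measurability

/-- A state as a triple of a tag and two vectors; unused vectors are zero. -/
def RState.enc : RState n → ℕ × E n × E n
  | .call x => (0, x, 0)
  | .inner x ζ => (1, x, ζ)
  | .done x => (2, x, 0)

instance RState.instMeasurableSpace : MeasurableSpace (RState n) :=
  MeasurableSpace.comap RState.enc inferInstance

theorem RState.measurable_enc : Measurable (RState.enc (n := n)) := comap_measurable _

theorem RState.measurable_iff {α : Type*} [MeasurableSpace α] {s : α → RState n} :
    Measurable s ↔ Measurable fun a => (s a).enc := measurable_comap_iff

theorem RState.measurable_call : Measurable (RState.call (n := n)) :=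
  RState.measurable_iff.2 (measurable_const.prodMk (measurable_id.prodMk measurable_const))

theorem RState.measurable_done : Measurable (RState.done (n := n)) :=
  RState.measurable_iff.2 (measurable_const.prodMk (measurable_id.prodMk measurable_const))

theorem RState.measurable_inner : Measurable fun p : E n × E n => RState.inner p.1 p.2 :=
  RState.measurable_iff.2 (measurable_const.prodMk measurable_id)

/-- A function of a state and a parameter is measurable if it is so on each kind of states. -/
theorem RState.measurable_of_cases {α β : Type*} [MeasurableSpace α] [MeasurableSpace β]
    {h : RState n → α → β} (h₀ : Measurable fun p : E n × α => h (.call p.1) p.2)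
    (h₁ : Measurable fun p : (E n × E n) × α => h (.inner p.1.1 p.1.2) p.2)
    (h₂ : Measurable fun p : E n × α => h (.done p.1) p.2) :
    Measurable fun p : RState n × α => h p.1 p.2 := by
  have henc : Measurable fun p : RState n × α => p.1.enc := RState.measurable_enc.comp measurable_fst
  have htag : Measurable fun p : RState n × α => p.1.enc.1 := measurable_fst.comp henc
  have hx : Measurable fun p : RState n × α => (p.1.enc.2.1, p.2) :=
    (measurable_fst.comp (measurable_snd.comp henc)).prodMk measurable_snd
  have hxζ : Measurable fun p : RState n × α => (p.1.enc.2, p.2) :=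
    (measurable_snd.comp henc).prodMk measurable_snd
  have heq : (fun p : RState n × α => h p.1 p.2) = fun p : RState n × α =>
      if p.1.enc.1 = 0 then h (.call p.1.enc.2.1) p.2
      else if p.1.enc.1 = 1 then h (.inner p.1.enc.2.1 p.1.enc.2.2) p.2
      else h (.done p.1.enc.2.1) p.2 := by
    funext p
    rcases p with ⟨x | ⟨x, ζ⟩ | x, a⟩ <;> simp [RState.enc]
  rw [heq]
  exact Measurable.ite (htag (measurableSet_singleton 0)) (h₀.comp hx)
    (Measurable.ite (htag (measurableSet_singleton 1)) (h₁.comp hxζ) (h₂.comp hx))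

theorem measurable_minNormSeg : Measurable fun p : E n × E n => minNormSeg p.1 p.2 := by
  unfold minNormSeg
  simp only [AffineMap.lineMap_apply_module]
  have h1 : Measurable fun p : E n × E n => ⟪p.1, p.1 - p.2⟫_ℝ :=
    measurable_fst.inner (measurable_fst.sub measurable_snd)
  fun_prop

theorem measurable_move : Measurable fun p : ℝ × E n × E n => move p.1 p.2.1 p.2.2 := by
  unfold move
  fun_prop

variable {f g : E n → ℝ} {Gf Gg : E n → E n} {δ ε : ℝ}

theorem measurable_gradOracle (hf : Measurable f) (hg : Measurable g) (hGf : Measurable Gf)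
    (hGg : Measurable Gg) : Measurable fun p : E n × E n => gradOracle f g Gf Gg p.1 p.2 := by
  refine Measurable.ite ?_ (hGf.comp measurable_snd) (hGg.comp measurable_snd)
  exact measurableSet_le (hg.comp measurable_snd)
    ((hf.comp measurable_snd).sub (hf.comp measurable_fst))

theorem measurable_hFun (hf : Measurable f) (hg : Measurable g) :
    Measurable fun p : E n × E n => hFun f g p.1 p.2 :=
  ((hf.comp measurable_snd).sub (hf.comp measurable_fst)).max (hg.comp measurable_snd)

theorem measurable_settle (hf : Measurable f) (hg : Measurable g) (δ ε : ℝ) :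
    Measurable fun p : E n × E n => RState.settle f g δ ε p.1 p.2 := by
  have hn : Measurable fun p : E n × E n => ‖p.2‖ := measurable_snd.norm
  have hm : Measurable fun p : E n × E n => move δ p.1 p.2 :=
    measurable_move.comp (measurable_const.prodMk measurable_id)
  have hh : Measurable fun p : E n × E n =>
      hFun f g p.1 p.1 - hFun f g p.1 (move δ p.1 p.2) :=
    ((measurable_hFun hf hg).comp (measurable_fst.prodMk measurable_fst)).sub
      ((measurable_hFun hf hg).comp (measurable_fst.prodMk hm))
  refine Measurable.ite ?_ RState.measurable_inner (Measurable.ite ?_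
    (RState.measurable_done.comp measurable_fst) (RState.measurable_call.comp hm))
  · exact (measurableSet_lt measurable_const hn).inter
      (measurableSet_le hh ((hn.const_mul δ).div_const 4))
  · exact measurableSet_le hn measurable_const

/-- The point at which the oracle is called in the step out of a state (`x` if it is `done x`). -/
noncomputable def RState.sample (δ r : ℝ) (u : E n) (v : ℝ) : RState n → E n
  | .call x => x + δ • u
  | .inner x ζ => move (v * δ) x (ζ + r • u)
  | .done x => x

theorem measurable_sample (δ : ℝ) :
    Measurable fun p : RState n × ℝ × E n × ℝ => p.1.sample δ p.2.1 p.2.2.1 p.2.2.2 := by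
  refine RState.measurable_of_cases (h := fun s (a : ℝ × E n × ℝ) => s.sample δ a.1 a.2.1 a.2.2)
    ?_ ?_ ?_
  · simp only [RState.sample]; fun_prop
  · simp only [RState.sample, move]; fun_prop
  · simp only [RState.sample]; fun_prop

theorem measurable_step (hf : Measurable f) (hg : Measurable g) (hGf : Measurable Gf)
    (hGg : Measurable Gg) (δ ε : ℝ) :
    Measurable fun p : RState n × ℝ × E n × ℝ =>
      RState.step f g Gf Gg δ ε p.2.1 p.2.2.1 p.2.2.2 p.1 := by
  have hs := measurable_settle hf hg δ ε
  have ho := measurable_gradOracle hf hg hGf hGg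
  refine RState.measurable_of_cases
    (h := fun s (a : ℝ × E n × ℝ) => RState.step f g Gf Gg δ ε a.1 a.2.1 a.2.2 s) ?_ ?_ ?_
  · have hz : Measurable fun q : E n × ℝ × E n × ℝ => q.1 + δ • q.2.2.1 := by fun_prop
    have hw : Measurable fun q : E n × ℝ × E n × ℝ =>
        gradOracle f g Gf Gg q.1 (q.1 + δ • q.2.2.1) := ho.comp (measurable_fst.prodMk hz)
    simp only [RState.step]
    have h := hs.comp (measurable_fst.prodMk hw)
    exact h
  · have hx : Measurable fun q : (E n × E n) × ℝ × E n × ℝ => q.1.1 := by fun_prop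
    have hζ : Measurable fun q : (E n × E n) × ℝ × E n × ℝ => q.1.2 := by fun_prop
    have hz : Measurable fun q : (E n × E n) × ℝ × E n × ℝ =>
        move (q.2.2.2 * δ) q.1.1 (q.1.2 + q.2.1 • q.2.2.1) := by
      unfold move
      fun_prop
    have hw : Measurable fun q : (E n × E n) × ℝ × E n × ℝ => gradOracle f g Gf Gg q.1.1
        (move (q.2.2.2 * δ) q.1.1 (q.1.2 + q.2.1 • q.2.2.1)) := by
      have h := ho.comp (hx.prodMk hz)
      exact h
    have hm : Measurable fun q : (E n × E n) × ℝ × E n × ℝ => minNormSeg q.1.2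
        (gradOracle f g Gf Gg q.1.1 (move (q.2.2.2 * δ) q.1.1 (q.1.2 + q.2.1 • q.2.2.1))) := by
      have h := measurable_minNormSeg.comp (hζ.prodMk hw)
      exact h
    simp only [RState.step]
    have h := hs.comp (hx.prodMk hm)
    exact h
  · exact RState.measurable_done.comp measurable_fst

end Measurability

/-! ### The potential of the randomized method -/

section Potential

variable {f g : E n → ℝ} {Gf Gg : E n → E n} {S Z : Set (E n)} {M : ℝ≥0} {δ ε p : ℝ}

/-- The bound `⌈max {1, 4 (f(x) - p) / (δ ε)}⌉` for the number of calls of the subroutine. -/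
noncomputable def callBound (f : E n → ℝ) (δ ε p : ℝ) (x : E n) : ℕ :=
  ⌈max 1 (4 * (f x - p) / (δ * ε))⌉₊

theorem one_le_callBound (x : E n) : 1 ≤ callBound f δ ε p x :=
  Nat.one_le_ceil_iff.2 (zero_lt_one.trans_le (le_max_left _ _))

theorem callBound_lt (hδ : 0 < δ) (hε : 0 < ε) {x y : E n} (hp : p ≤ f y)
    (h : f y < f x - δ * ε / 4) : callBound f δ ε p y < callBound f δ ε p x := by
  have hδε : 0 < δ * ε := by positivity
  have h1 : 4 * (f y - p) / (δ * ε) + 1 < 4 * (f x - p) / (δ * ε) := by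
    rw [div_add_one hδε.ne', div_lt_div_iff_of_pos_right hδε]
    linarith
  have h0 : 0 ≤ 4 * (f y - p) / (δ * ε) := div_nonneg (by linarith) hδε.le
  rw [callBound, callBound, Nat.lt_ceil]
  refine lt_of_lt_of_le ?_ (le_max_right _ _)
  rcases le_total (4 * (f y - p) / (δ * ε)) 1 with h2 | h2
  · rw [max_eq_left h2, Nat.ceil_one]
    push_cast
    linarith
  · rw [max_eq_right h2]
    exact (Nat.ceil_lt_add_one h0).trans h1

/-- The potential: it is at least one before termination, and decreases in expectation by a constant
factor with each oracle call. Its part `1 - ε² / (2 ‖ζ‖²)` is a concave function of `‖ζ‖²`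
whose derivative compensates the slow decrease of `‖ζ‖²` when `‖ζ‖` is small. -/
noncomputable def RState.potential (f : E n → ℝ) (δ ε p : ℝ) : RState n → ℝ
  | .call x => 2 ^ callBound f δ ε p x
  | .inner x ζ => 2 ^ callBound f δ ε p x * (1 - ε ^ 2 / (2 * ‖ζ‖ ^ 2))
  | .done _ => 0

theorem measurable_potential (hf : Measurable f) :
    Measurable (RState.potential f δ ε p) := by
  have hN : Measurable (callBound f δ ε p) := by
    unfold callBound
    exact Nat.measurable_ceil.comp (by fun_prop)
  have h2 : Measurable fun x : E n => (2 : ℝ) ^ callBound f δ ε p x :=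
    (measurable_from_nat (f := fun k : ℕ => (2 : ℝ) ^ k)).comp hN
  have h := RState.measurable_of_cases (α := Unit) (h := fun s _ => RState.potential f δ ε p s)
    (h2.comp measurable_fst)
    ((h2.comp (measurable_fst.comp measurable_fst)).mul (by fun_prop)) measurable_const
  exact h.comp (measurable_id.prodMk (measurable_const (a := ())))

/-- The values of the oracle for `h_x` on `B(x, δ)` outside the exceptional set `Z`. -/
def gradValues (f g : E n → ℝ) (Gf Gg : E n → E n) (δ : ℝ) (Z : Set (E n)) (x : E n) :
    Set (E n) :=
  {w | ∃ z ∈ Metric.closedBall x δ, z ∉ Z ∧ w = gradOracle f g Gf Gg x z}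

/-- The states that the method reaches almost surely: feasible outer iterates, inner vectors that
are convex combinations of oracle values, and the `while` condition inside the loop. -/
def RState.Valid (f g : E n → ℝ) (Gf Gg : E n → E n) (δ ε : ℝ) (S Z : Set (E n)) :
    RState n → Prop
  | .call x => x ∈ S
  | .inner x ζ => x ∈ S ∧ ζ ∈ convexHull ℝ (gradValues f g Gf Gg δ Z x) ∧ ε < ‖ζ‖ ∧
      hFun f g x x - hFun f g x (move δ x ζ) ≤ δ * ‖ζ‖ / 4
  | .done x => x ∈ S ∧ ∃ ξ ∈ convexHull ℝ (gradValues f g Gf Gg δ Z x), ‖ξ‖ ≤ ε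

/-- The radius `r` is admissible in the given state. -/
def RState.RadiusOK (M r : ℝ) (s : RState n) : Prop :=
  ∀ x ζ, s = .inner x ζ → 0 < r ∧ r < ‖ζ‖ * √(1 - (1 - ‖ζ‖ ^ 2 / (128 * M ^ 2)) ^ 2)

/-- The hypotheses of the analysis of the randomized method, for globally Lipschitz `f` and `g` and
an exceptional null set `Z` of the gradient oracles. -/
structure IsRandomModel (f g : E n → ℝ) (Gf Gg : E n → E n) (S Z : Set (E n)) (M : ℝ≥0)
    (δ ε p : ℝ) : Prop where
  local_model : IsLocalModel f g S M δ p
  lip_f : LipschitzWith M f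
  lip_g : LipschitzWith M g
  measurable_f : Measurable Gf
  measurable_g : Measurable Gg
  measurableSet : MeasurableSet Z
  null : (volume : Measure (E n)) Z = 0
  grad : ∀ x ∈ S, ∀ z ∈ Metric.closedBall x δ, z ∉ Z →
    HasGradientAt f (Gf z) z ∧ HasGradientAt g (Gg z) z
  pos_M : 0 < M
  pos_δ : 0 < δ
  pos_ε : 0 < ε

theorem IsRandomModel.norm_gradValues_le (hR : IsRandomModel f g Gf Gg S Z M δ ε p) {x : E n}
    (hx : x ∈ S) {w : E n} (hw : w ∈ gradValues f g Gf Gg δ Z x) : ‖w‖ ≤ M := by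
  obtain ⟨z, hz, hzZ, rfl⟩ := hw
  obtain ⟨h1, h2⟩ := hR.grad x hx z hz hzZ
  unfold gradOracle
  split_ifs
  exacts [norm_gradient_le hR.lip_f h1, norm_gradient_le hR.lip_g h2]

theorem IsRandomModel.norm_le (hR : IsRandomModel f g Gf Gg S Z M δ ε p) {x : E n}
    (hx : x ∈ S) {w : E n} (hw : w ∈ convexHull ℝ (gradValues f g Gf Gg δ Z x)) : ‖w‖ ≤ M := by
  have : convexHull ℝ (gradValues f g Gf Gg δ Z x) ⊆ Metric.closedBall 0 M :=
    convexHull_min (fun w hw => by simpa using hR.norm_gradValues_le hx hw) (convex_closedBall _ _)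
  simpa using this hw

/-- A move of the outer method stays in `S` and lowers `f` by more than `δ ε / 4`. -/
theorem IsRandomModel.descent (hR : IsRandomModel f g Gf Gg S Z M δ ε p) {x ζ : E n}
    (hx : x ∈ S) (hζ : ε < ‖ζ‖)
    (h : ¬ hFun f g x x - hFun f g x (move δ x ζ) ≤ δ * ‖ζ‖ / 4) :
    move δ x ζ ∈ S ∧ f (move δ x ζ) < f x - δ * ε / 4 := by
  have hδ := hR.pos_δ
  obtain ⟨h1, h2⟩ := hR.local_model.descent hx (move_mem_closedBall hR.pos_δ.le x ζ)
    (by positivity) (not_le.1 h).le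
  refine ⟨h1, h2.trans_lt ?_⟩
  have := mul_lt_mul_of_pos_left hζ hR.pos_δ
  linarith

theorem IsRandomModel.valid_settle (hR : IsRandomModel f g Gf Gg S Z M δ ε p) {x ζ : E n}
    (hx : x ∈ S) (hζ : ζ ∈ convexHull ℝ (gradValues f g Gf Gg δ Z x)) :
    (RState.settle f g δ ε x ζ).Valid f g Gf Gg δ ε S Z := by
  unfold RState.settle
  split_ifs with h1 h2
  · exact ⟨hx, hζ, h1⟩
  · exact ⟨hx, ζ, hζ, h2⟩
  · exact (hR.descent hx (not_le.1 h2) fun h => h1 ⟨not_le.1 h2, h⟩).1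

theorem IsRandomModel.potential_settle_nonneg (hR : IsRandomModel f g Gf Gg S Z M δ ε p)
    (x ζ : E n) : 0 ≤ (RState.settle f g δ ε x ζ).potential f δ ε p := by
  have hε := hR.pos_ε
  unfold RState.settle
  split_ifs with h1 h2
  · have : ε ^ 2 / (2 * ‖ζ‖ ^ 2) ≤ 1 := by
      have h2 : ε ^ 2 ≤ ‖ζ‖ ^ 2 := by have := h1.1.le; gcongr
      rw [div_le_one (by nlinarith)]
      nlinarith
    exact mul_nonneg (by positivity) (by linarith)
  · exact le_rfl
  · simp only [RState.potential]; positivity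

theorem IsRandomModel.potential_settle_le_of_lt (hR : IsRandomModel f g Gf Gg S Z M δ ε p)
    {x ζ : E n} (hx : x ∈ S) (hζ : ε < ‖ζ‖) :
    (RState.settle f g δ ε x ζ).potential f δ ε p ≤
      2 ^ callBound f δ ε p x * (1 - ε ^ 2 / (2 * ‖ζ‖ ^ 2)) := by
  have hε := hR.pos_ε
  unfold RState.settle
  split_ifs with h1 h2
  · exact le_rfl
  · exact absurd hζ (not_lt.2 h2)
  · obtain ⟨h3, h4⟩ := hR.descent hx hζ fun h => h1 ⟨hζ, h⟩
    have h5 := callBound_lt hR.pos_δ hε (hR.local_model.bound _ h3) h4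
    have h6 : ε ^ 2 / (2 * ‖ζ‖ ^ 2) ≤ 1 / 2 := by
      have h7 : ε ^ 2 ≤ ‖ζ‖ ^ 2 := by gcongr
      rw [div_le_div_iff₀ (by nlinarith) two_pos]
      linarith
    calc (2 : ℝ) ^ callBound f δ ε p (move δ x ζ)
        = 2 ^ (callBound f δ ε p (move δ x ζ) + 1) * (1 / 2) := by rw [pow_succ]; ring
      _ ≤ 2 ^ callBound f δ ε p x * (1 - ε ^ 2 / (2 * ‖ζ‖ ^ 2)) := by
        gcongr
        · norm_num
        · omega
        · linarith

theorem potential_settle_of_le {x ζ : E n} (hζ : ‖ζ‖ ≤ ε) :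
    (RState.settle f g δ ε x ζ).potential f δ ε p = 0 := by
  rw [RState.settle, if_neg (fun h => not_lt.2 hζ h.1), if_pos hζ]
  rfl

/-- The potential after a loop step, bounded by the tangent line of `q ↦ 1 - ε² / (2 q)`. -/
theorem IsRandomModel.potential_settle_le_tangent (hR : IsRandomModel f g Gf Gg S Z M δ ε p)
    {x ζ : E n} (hx : x ∈ S) {q : ℝ} (hq : ε ^ 2 ≤ q) :
    (RState.settle f g δ ε x ζ).potential f δ ε p ≤
      2 ^ callBound f δ ε p x * (1 - ε ^ 2 / q + ε ^ 2 * ‖ζ‖ ^ 2 / (2 * q ^ 2)) := by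
  have hε := hR.pos_ε
  have hq0 : 0 < q := (pow_pos hε 2).trans_le hq
  rcases le_or_gt ‖ζ‖ ε with hζ | hζ
  · rw [potential_settle_of_le hζ]
    have h1 : ε ^ 2 / q ≤ 1 := (div_le_one hq0).2 hq
    have h2 : 0 ≤ ε ^ 2 * ‖ζ‖ ^ 2 / (2 * q ^ 2) := by positivity
    exact mul_nonneg (by positivity) (by linarith)
  · refine (hR.potential_settle_le_of_lt hx hζ).trans ?_
    have hζ0 : 0 < ‖ζ‖ := hε.trans hζ
    gcongr
    have : 1 - ε ^ 2 / q + ε ^ 2 * ‖ζ‖ ^ 2 / (2 * q ^ 2) - (1 - ε ^ 2 / (2 * ‖ζ‖ ^ 2)) =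
        ε ^ 2 * (‖ζ‖ ^ 2 - q) ^ 2 / (2 * q ^ 2 * ‖ζ‖ ^ 2) := by field_simp; ring
    have h2 : 0 ≤ ε ^ 2 * (‖ζ‖ ^ 2 - q) ^ 2 / (2 * q ^ 2 * ‖ζ‖ ^ 2) := by positivity
    linarith

/-- The potential after a loop step with oracle vector `w` is bounded by a contraction of the old
potential and a term that has nonpositive mean. -/
theorem IsRandomModel.potential_settle_minNormSeg_le
    (hR : IsRandomModel f g Gf Gg S Z M δ ε p) {x ζ w : E n} (hx : x ∈ S) (hζ : ε < ‖ζ‖)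
    (hζM : ‖ζ‖ ≤ M) (hw : ‖w‖ ≤ M) :
    (RState.settle f g δ ε x (minNormSeg ζ w)).potential f δ ε p ≤
      2 ^ callBound f δ ε p x * (1 - ε ^ 2 / (2 * ‖ζ‖ ^ 2) - ε ^ 2 / (8 * M ^ 2)) +
      2 ^ callBound f δ ε p x * (ε ^ 2 / (2 * (‖ζ‖ ^ 2) ^ 2) *
        (2 * (‖ζ‖ ^ 2 / (2 * M ^ 2)) * (1 - ‖ζ‖ ^ 2 / (2 * M ^ 2)))) *
        (⟪w, ζ⟫_ℝ - ‖ζ‖ ^ 2 / 2) := by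
  have hε := hR.pos_ε
  have hM : (0 : ℝ) < M := hR.pos_M
  have hζ0 : 0 < ‖ζ‖ := hε.trans hζ
  have h1 := norm_minNormSeg_sq_le hM hζM hw
  have h2 := hR.potential_settle_le_tangent (ζ := minNormSeg ζ w) hx (q := ‖ζ‖ ^ 2) (by gcongr)
  set q := ‖ζ‖ ^ 2
  have hq0 : 0 < q := by positivity
  set R := 2 * (q / (2 * M ^ 2)) * (1 - q / (2 * M ^ 2)) * (⟪w, ζ⟫_ℝ - q / 2) with hRdef
  calc _ ≤ _ := h2
    _ ≤ 2 ^ callBound f δ ε p x * (1 - ε ^ 2 / q +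
        ε ^ 2 * (q - q ^ 2 / (4 * M ^ 2) + R) / (2 * q ^ 2)) := by gcongr
    _ = _ := by rw [hRdef]; field_simp; ring

end Potential

/-! ### The expected decrease of the potential -/

/-- The range of the random input of one step. -/
def inputSet (n : ℕ) : Set (E n × ℝ) := Metric.closedBall (0 : E n) 1 ×ˢ Icc (0 : ℝ) 1

theorem measurableSet_inputSet : MeasurableSet (inputSet n) :=
  Metric.isClosed_closedBall.measurableSet.prod measurableSet_Icc

theorem volume_inputSet : (volume : Measure (E n × ℝ)) (inputSet n) =
    (volume : Measure (E n)) (Metric.closedBall 0 1) := by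
  rw [inputSet, Measure.volume_eq_prod, Measure.prod_prod, Real.volume_Icc]
  simp

theorem volume_inputSet_ne_zero : (volume : Measure (E n × ℝ)) (inputSet n) ≠ 0 := by
  rw [volume_inputSet]
  exact (Metric.measure_closedBall_pos volume _ one_pos).ne'

theorem volume_inputSet_ne_top : (volume : Measure (E n × ℝ)) (inputSet n) ≠ ∞ := by
  rw [volume_inputSet]
  exact measure_closedBall_lt_top.ne

/-- The uniform distribution of the random input of one step. -/
noncomputable def inputLaw (n : ℕ) : Measure (E n × ℝ) :=
  ProbabilityTheory.cond volume (inputSet n)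

instance : IsProbabilityMeasure (inputLaw n) :=
  cond_isProbabilityMeasure_of_finite volume_inputSet_ne_zero volume_inputSet_ne_top

theorem integral_inputLaw_le {c : E n × ℝ → ℝ} {Q : ℝ}
    (hc : IntegrableOn c (inputSet n) volume)
    (h : ∀ᵐ u : E n, u ∈ Metric.closedBall (0 : E n) 1 → ∫ v in Icc (0 : ℝ) 1, c (u, v) ≤ Q) :
    ∫ y, c y ∂(inputLaw n) ≤ Q := by
  have hball : (volume : Measure (E n)) (Metric.closedBall 0 1) ≠ ∞ := measure_closedBall_lt_top.ne
  rw [inputLaw, ProbabilityTheory.cond, integral_smul_measure, volume_inputSet]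
  rw [inputSet, Measure.volume_eq_prod] at hc ⊢
  rw [setIntegral_prod _ hc]
  have h1 : ∫ u in Metric.closedBall (0 : E n) 1, ∫ v in Icc (0 : ℝ) 1, c (u, v) ≤
      ∫ _u in Metric.closedBall (0 : E n) 1, Q := by
    refine integral_mono_ae ?_ ?_ ?_
    · rw [IntegrableOn, ← Measure.prod_restrict] at hc
      exact hc.integral_prod_left
    · exact integrableOn_const hball
    · exact (ae_restrict_iff' Metric.isClosed_closedBall.measurableSet).2 h
  rw [setIntegral_const, smul_eq_mul] at h1
  have h2 : 0 < (volume : Measure (E n)).real (Metric.closedBall 0 1) :=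
    ENNReal.toReal_pos (Metric.measure_closedBall_pos volume _ one_pos).ne' hball
  rw [smul_eq_mul, ENNReal.toReal_inv]
  rw [Measure.real] at h1 h2
  rw [inv_mul_le_iff₀ h2]
  exact h1

section OneStep

variable {f g : E n → ℝ} {Gf Gg : E n → E n} {S Z : Set (E n)} {M : ℝ≥0} {δ ε p : ℝ}

theorem sample_call_mem_closedBall (hδ : 0 ≤ δ) (x : E n) {r : ℝ} {y : E n × ℝ}
    (hy : y ∈ inputSet n) :
    (RState.call x).sample δ r y.1 y.2 ∈ Metric.closedBall x δ := by
  have h1 : ‖y.1‖ ≤ 1 := by simpa using hy.1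
  rw [RState.sample, mem_closedBall_iff_norm, add_sub_cancel_left, norm_smul,
    Real.norm_of_nonneg hδ]
  exact mul_le_of_le_one_right hδ h1

theorem sample_inner_mem_closedBall (hδ : 0 ≤ δ) (x ζ : E n) {r : ℝ} {y : E n × ℝ}
    (hy : y ∈ inputSet n) :
    (RState.inner x ζ).sample δ r y.1 y.2 ∈ Metric.closedBall x δ :=
  Metric.closedBall_subset_closedBall (mul_le_of_le_one_left hδ hy.2.2)
    (move_mem_closedBall (mul_nonneg hy.2.1 hδ) _ _)

theorem norm_perturb_sub_le {r : ℝ} (hr : 0 ≤ r) (ζ : E n) {u : E n}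
    (hu : u ∈ Metric.closedBall (0 : E n) 1) : ‖(ζ + r • u) - ζ‖ ≤ r := by
  have h1 : ‖u‖ ≤ 1 := by simpa using hu
  rw [add_sub_cancel_left, norm_smul, Real.norm_of_nonneg hr]
  exact mul_le_of_le_one_right hr h1

/-- In the loop, for almost every `u` and almost every `v`, the sample avoids the exceptional
set. -/
theorem IsRandomModel.ae_ae_sample_inner_notMem (hR : IsRandomModel f g Gf Gg S Z M δ ε p)
    {x ζ : E n} (hx : x ∈ S) (hζ : ζ ∈ convexHull ℝ (gradValues f g Gf Gg δ Z x)) (hζε : ε < ‖ζ‖)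
    {r : ℝ} (hr0 : 0 < r) (hr : r < ‖ζ‖ * √(1 - (1 - ‖ζ‖ ^ 2 / (128 * (M : ℝ) ^ 2)) ^ 2)) :
    ∀ᵐ u : E n, ∀ᵐ v : ℝ, u ∈ Metric.closedBall (0 : E n) 1 →
      move (v * δ) x (ζ + r • u) ∉ Z := by
  have hζ0 : ζ ≠ 0 := norm_pos_iff.1 (hR.pos_ε.trans hζε)
  have h1 := ae_comp_add_smul volume (ae_ae_move_notMem hR.measurableSet hR.null hR.pos_δ x) ζ
    hr0.ne'
  filter_upwards [h1] with u hu
  filter_upwards [hu] with v hv hu1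
  exact hv (norm_unitVec_sub_le hR.pos_M hζ0 (hR.norm_le hx hζ) hr
    (norm_perturb_sub_le hr0.le ζ hu1)).1

/-- From a valid state, almost surely the oracle is called outside the exceptional set. -/
theorem IsRandomModel.ae_sample_notMem (hR : IsRandomModel f g Gf Gg S Z M δ ε p) {s : RState n}
    (hs : s.Valid f g Gf Gg δ ε S Z) {r : ℝ} (hr : s.RadiusOK M r) :
    ∀ᵐ y ∂(inputLaw n), s.enc.1 = 2 ∨ s.sample δ r y.1 y.2 ∉ Z := by
  have habs : inputLaw n ≪ (volume : Measure (E n × ℝ)) := cond_absolutelyContinuous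
  rcases s with x | ⟨x, ζ⟩ | x
  · have h1 : ∀ᵐ z : E n, z ∉ Z := by simpa [ae_iff] using hR.null
    have h2 := ae_comp_add_smul volume h1 x hR.pos_δ.ne'
    have h3 : ∀ᵐ y : E n × ℝ, x + δ • y.1 ∉ Z :=
      Measure.quasiMeasurePreserving_fst.ae h2
    filter_upwards [habs.ae_le h3] with y hy
    exact .inr hy
  · obtain ⟨hx, hζ, hζε, -⟩ := hs
    obtain ⟨hr0, hr1⟩ := hr x ζ rfl
    have h1 := hR.ae_ae_sample_inner_notMem hx hζ hζε hr0 hr1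
    have hmeas : MeasurableSet {y : E n × ℝ | y.1 ∈ Metric.closedBall (0 : E n) 1 →
        move (y.2 * δ) x (ζ + r • y.1) ∉ Z} := by
      have hz : Measurable fun y : E n × ℝ => move (y.2 * δ) x (ζ + r • y.1) := by
        unfold move; fun_prop
      have h2 : MeasurableSet {y : E n × ℝ | y.1 ∈ Metric.closedBall (0 : E n) 1} :=
        measurable_fst Metric.isClosed_closedBall.measurableSet
      have h3 : MeasurableSet {y : E n × ℝ | move (y.2 * δ) x (ζ + r • y.1) ∉ Z} :=
        (hz hR.measurableSet).compl
      exact h2.imp h3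
    have h2 := (Measure.ae_prod_iff_ae_ae hmeas).2 h1
    rw [← Measure.volume_eq_prod] at h2
    filter_upwards [habs.ae_le h2, ae_cond_mem measurableSet_inputSet] with y hy hy'
    exact .inr (hy hy'.1)
  · exact .of_forall fun _ => .inl rfl

theorem IsRandomModel.valid_step (hR : IsRandomModel f g Gf Gg S Z M δ ε p) {s : RState n}
    (hs : s.Valid f g Gf Gg δ ε S Z) {r : ℝ} {y : E n × ℝ} (hy : y ∈ inputSet n)
    (hZ : s.enc.1 = 2 ∨ s.sample δ r y.1 y.2 ∉ Z) :
    (RState.step f g Gf Gg δ ε r y.1 y.2 s).Valid f g Gf Gg δ ε S Z := by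
  rcases s with x | ⟨x, ζ⟩ | x
  · refine hR.valid_settle hs (subset_convexHull _ _ ⟨_, ?_, hZ.resolve_left (by simp [RState.enc]),
      rfl⟩)
    exact sample_call_mem_closedBall (r := r) hR.pos_δ.le x hy
  · obtain ⟨hx, hζ, -, -⟩ := hs
    refine hR.valid_settle hx ((convex_convexHull ℝ _).segment_subset hζ
      (subset_convexHull _ _ ⟨_, ?_, hZ.resolve_left (by simp [RState.enc]), rfl⟩)
      (minNormSeg_mem _ _))
    exact sample_inner_mem_closedBall hR.pos_δ.le x ζ hy
  · exact hs

theorem IsRandomModel.integral_inner_le (hR : IsRandomModel f g Gf Gg S Z M δ ε p)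
    {x ζ : E n} (hs : (RState.inner x ζ).Valid f g Gf Gg δ ε S Z) {r : ℝ}
    (hr : (RState.inner x ζ).RadiusOK M r) :
    Integrable (fun y : E n × ℝ =>
      ⟪gradOracle f g Gf Gg x (move (y.2 * δ) x (ζ + r • y.1)), ζ⟫_ℝ) (inputLaw n) ∧
    ∫ y : E n × ℝ, ⟪gradOracle f g Gf Gg x (move (y.2 * δ) x (ζ + r • y.1)), ζ⟫_ℝ
      ∂(inputLaw n) ≤ ‖ζ‖ ^ 2 / 2 := by
  have hae := hR.ae_sample_notMem hs hr
  obtain ⟨hx, hζ, hζε, hd⟩ := hs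
  obtain ⟨hr0, hr1⟩ := hr x ζ rfl
  have hζ0 : ζ ≠ 0 := norm_pos_iff.1 (hR.pos_ε.trans hζε)
  have hmeas : Measurable fun y : E n × ℝ =>
      ⟪gradOracle f g Gf Gg x (move (y.2 * δ) x (ζ + r • y.1)), ζ⟫_ℝ := by
    have hz : Measurable fun y : E n × ℝ => move (y.2 * δ) x (ζ + r • y.1) := by
      unfold move; fun_prop
    have hw := (measurable_gradOracle hR.lip_f.continuous.measurable
      hR.lip_g.continuous.measurable hR.measurable_f hR.measurable_g).comp
      ((measurable_const (a := x)).prodMk hz)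
    exact Measurable.inner hw measurable_const
  have hbound : ∀ᵐ y ∂(inputLaw n),
      ‖⟪gradOracle f g Gf Gg x (move (y.2 * δ) x (ζ + r • y.1)), ζ⟫_ℝ‖ ≤ M * ‖ζ‖ := by
    filter_upwards [hae, ae_cond_mem measurableSet_inputSet] with y hy hy'
    have h1 := hR.norm_gradValues_le hx ⟨_, sample_inner_mem_closedBall (r := r) hR.pos_δ.le x ζ hy',
      hy.resolve_left (by simp [RState.enc]), rfl⟩
    exact (norm_inner_le_norm _ _).trans (by gcongr; exact h1)
  have hint := Integrable.of_bound (C := M * ‖ζ‖) hmeas.aestronglyMeasurable hbound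
  refine ⟨hint, integral_inputLaw_le ?_ ?_⟩
  · rw [inputLaw, ProbabilityTheory.cond, integrable_smul_measure
      (ENNReal.inv_ne_zero.2 volume_inputSet_ne_top)
      (ENNReal.inv_ne_top.2 volume_inputSet_ne_zero)] at hint
    exact hint
  · filter_upwards [hR.ae_ae_sample_inner_notMem hx hζ hζε hr0 hr1] with u hu hu1
    refine integral_inner_gradOracle_le hR.pos_M hR.lip_f hR.lip_g hR.measurable_f hR.measurable_g
      hR.pos_δ x hζ0 (hR.norm_le hx hζ) hr1 (norm_perturb_sub_le hr0.le ζ hu1) hd ?_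
    filter_upwards [hu] with v hv hv01
    exact hR.grad x hx _ (sample_inner_mem_closedBall (r := r) (y := (u, v)) hR.pos_δ.le x ζ
      ⟨hu1, hv01⟩) (hv hu1)

/-- The factor by which the expected potential decreases in each step. -/
noncomputable def contraction (ε : ℝ) (M : ℝ) : ℝ := Real.exp (-(ε ^ 2 / (8 * M ^ 2)))

/-- The potential contracts in expectation. -/
theorem IsRandomModel.lintegral_potential_step_le (hR : IsRandomModel f g Gf Gg S Z M δ ε p)
    {s : RState n} (hs : s.Valid f g Gf Gg δ ε S Z) {r : ℝ} (hr : s.RadiusOK M r) :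
    ∫⁻ y, ENNReal.ofReal ((RState.step f g Gf Gg δ ε r y.1 y.2 s).potential f δ ε p) ∂(inputLaw n)
      ≤ ENNReal.ofReal (contraction ε M) * ENNReal.ofReal (s.potential f δ ε p) := by
  have hM : (0 : ℝ) < M := hR.pos_M
  have hε := hR.pos_ε
  have hexp : 1 - ε ^ 2 / (8 * (M : ℝ) ^ 2) ≤ contraction ε M := by
    have := Real.add_one_le_exp (-(ε ^ 2 / (8 * (M : ℝ) ^ 2)))
    rw [contraction]; linarith
  have hae := hR.ae_sample_notMem hs hr
  rw [← ENNReal.ofReal_mul (by rw [contraction]; positivity)]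
  rcases s with x | ⟨x, ζ⟩ | x
  · have hconst : ∀ᵐ y ∂(inputLaw n),
        ENNReal.ofReal ((RState.step f g Gf Gg δ ε r y.1 y.2 (.call x)).potential f δ ε p) ≤
        ENNReal.ofReal (contraction ε M * (RState.call x).potential f δ ε p) := by
      filter_upwards [hae, ae_cond_mem measurableSet_inputSet] with y hy hy'
      have h1 := hR.norm_gradValues_le hs ⟨_, sample_call_mem_closedBall (r := r) hR.pos_δ.le x hy',
        hy.resolve_left (by simp [RState.enc]), rfl⟩
      refine ENNReal.ofReal_le_ofReal ?_
      simp only [RState.step, RState.sample] at h1 ⊢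
      set w := gradOracle f g Gf Gg x (x + δ • y.1)
      rcases le_or_gt ‖w‖ ε with hw | hw
      · rw [potential_settle_of_le hw]
        simp only [RState.potential, contraction]
        positivity
      · refine (hR.potential_settle_le_of_lt hs hw).trans ?_
        rw [RState.potential, mul_comm]
        gcongr
        refine le_trans ?_ hexp
        have hw0 : 0 < ‖w‖ := hε.trans hw
        have : ε ^ 2 / (8 * (M : ℝ) ^ 2) ≤ ε ^ 2 / (2 * ‖w‖ ^ 2) := by
          have : ‖w‖ ^ 2 ≤ (M : ℝ) ^ 2 := by gcongr
          gcongr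
          linarith
        linarith
    refine (lintegral_mono_ae hconst).trans ?_
    simp
  · obtain ⟨hint, hle⟩ := hR.integral_inner_le hs hr
    obtain ⟨hx, hζ, hζε, hd⟩ := hs
    have hζM := hR.norm_le hx hζ
    have hζ0 : 0 < ‖ζ‖ := hε.trans hζε
    set c : E n × ℝ → ℝ := fun y =>
      ⟪gradOracle f g Gf Gg x (move (y.2 * δ) x (ζ + r • y.1)), ζ⟫_ℝ with hc
    obtain ⟨A, hA⟩ : ∃ A, A = (2 : ℝ) ^ callBound f δ ε p x *
      (1 - ε ^ 2 / (2 * ‖ζ‖ ^ 2) - ε ^ 2 / (8 * M ^ 2)) := ⟨_, rfl⟩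
    obtain ⟨B, hB⟩ : ∃ B, B = (2 : ℝ) ^ callBound f δ ε p x * (ε ^ 2 / (2 * (‖ζ‖ ^ 2) ^ 2) *
        (2 * (‖ζ‖ ^ 2 / (2 * M ^ 2)) * (1 - ‖ζ‖ ^ 2 / (2 * M ^ 2)))) := ⟨_, rfl⟩
    have hB0 : 0 ≤ B := by
      have h1 : ‖ζ‖ ^ 2 ≤ (M : ℝ) ^ 2 := by gcongr
      have h2 : ‖ζ‖ ^ 2 / (2 * (M : ℝ) ^ 2) ≤ 1 := by
        rw [div_le_one (by positivity)]; nlinarith [sq_nonneg (M : ℝ)]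
      rw [hB]
      exact mul_nonneg (by positivity) (mul_nonneg (by positivity)
        (mul_nonneg (by positivity) (by linarith)))
    have hpt : ∀ᵐ y ∂(inputLaw n),
        (RState.step f g Gf Gg δ ε r y.1 y.2 (.inner x ζ)).potential f δ ε p ≤
        A + B * (c y - ‖ζ‖ ^ 2 / 2) := by
      filter_upwards [hae, ae_cond_mem measurableSet_inputSet] with y hy hy'
      have h1 := hR.norm_gradValues_le hx ⟨_, sample_inner_mem_closedBall (r := r) hR.pos_δ.le x ζ
        hy', hy.resolve_left (by simp [RState.enc]), rfl⟩
      rw [hA, hB]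
      exact hR.potential_settle_minNormSeg_le hx hζε hζM h1
    have hInt : Integrable (fun y => A + B * (c y - ‖ζ‖ ^ 2 / 2)) (inputLaw n) :=
      (integrable_const _).add ((hint.sub (integrable_const _)).const_mul _)
    calc _ ≤ ∫⁻ y, ENNReal.ofReal (A + B * (c y - ‖ζ‖ ^ 2 / 2)) ∂(inputLaw n) :=
          lintegral_mono_ae (hpt.mono fun y hy => ENNReal.ofReal_le_ofReal hy)
      _ = ENNReal.ofReal (∫ y, (A + B * (c y - ‖ζ‖ ^ 2 / 2)) ∂(inputLaw n)) := by
          rw [ofReal_integral_eq_lintegral_ofReal hInt]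
          filter_upwards [hpt] with y hy
          exact (hR.potential_settle_nonneg _ _).trans hy
      _ ≤ _ := by
          refine ENNReal.ofReal_le_ofReal ?_
          have hsub : Integrable (fun y => c y - ‖ζ‖ ^ 2 / 2) (inputLaw n) :=
            hint.sub (integrable_const _)
          rw [integral_add (integrable_const _) (hsub.const_mul _), integral_const_mul,
            integral_sub hint (integrable_const _)]
          simp only [integral_const, probReal_univ, one_smul]
          have h1 : B * (∫ y, c y ∂(inputLaw n) - ‖ζ‖ ^ 2 / 2) ≤ 0 :=
            mul_nonpos_of_nonneg_of_nonpos hB0 (by linarith)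
          have h2 : A ≤ contraction ε M * (RState.inner x ζ).potential f δ ε p := by
            have h3 : ε ^ 2 / (2 * ‖ζ‖ ^ 2) ≤ 1 := by
              have : ε ^ 2 ≤ ‖ζ‖ ^ 2 := by gcongr
              rw [div_le_one (by positivity)]; nlinarith
            have h4 : 0 ≤ ε ^ 2 / (2 * ‖ζ‖ ^ 2) := by positivity
            have h5 : 0 ≤ ε ^ 2 / (8 * (M : ℝ) ^ 2) := by positivity
            rw [hA, RState.potential, mul_left_comm]
            gcongr
            calc _ ≤ (1 - ε ^ 2 / (8 * (M : ℝ) ^ 2)) * (1 - ε ^ 2 / (2 * ‖ζ‖ ^ 2)) := by nlinarith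
              _ ≤ _ := by gcongr
          linarith
  · simp [RState.step, RState.potential]

end OneStep

/-! ### Conditioning on the past -/

section Independence

variable {Ω α β : Type*} {m : MeasurableSpace Ω} [mΩ : MeasurableSpace Ω] [MeasurableSpace α]
  [MeasurableSpace β] {μ : Measure Ω} [IsProbabilityMeasure μ] {X : Ω → α} {Y : Ω → β}

theorem map_prodMk_of_indep (hm : m ≤ mΩ) (hX : Measurable[m] X) (hY : Measurable Y)
    (h : Indep (MeasurableSpace.comap Y inferInstance) m μ) :
    μ.map (fun ω => (X ω, Y ω)) = (μ.map X).prod (μ.map Y) := by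
  refine (indepFun_iff_map_prod_eq_prod_map_map (hX.mono hm le_rfl).aemeasurable
    hY.aemeasurable).1 ?_
  rw [IndepFun_iff_Indep]
  exact indep_of_indep_of_le_left h.symm hX.comap_le

theorem lintegral_comp_of_indep (hm : m ≤ mΩ) (hX : Measurable[m] X) (hY : Measurable Y)
    (h : Indep (MeasurableSpace.comap Y inferInstance) m μ) {H : α × β → ℝ≥0∞}
    (hH : Measurable H) :
    ∫⁻ ω, H (X ω, Y ω) ∂μ = ∫⁻ ω, ∫⁻ y, H (X ω, y) ∂(μ.map Y) ∂μ := by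
  have hX' : Measurable X := hX.mono hm le_rfl
  have : IsProbabilityMeasure (μ.map Y) := Measure.isProbabilityMeasure_map hY.aemeasurable
  rw [← lintegral_map hH (hX'.prodMk hY), map_prodMk_of_indep hm hX hY h,
    lintegral_prod _ hH.aemeasurable, lintegral_map hH.lintegral_prod_right' hX']

theorem ae_comp_of_indep (hm : m ≤ mΩ) (hX : Measurable[m] X) (hY : Measurable Y)
    (h : Indep (MeasurableSpace.comap Y inferInstance) m μ) {P : α × β → Prop}
    (hP : MeasurableSet {q | P q}) (hae : ∀ᵐ ω ∂μ, ∀ᵐ y ∂(μ.map Y), P (X ω, y)) :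
    ∀ᵐ ω ∂μ, P (X ω, Y ω) := by
  have hX' : Measurable X := hX.mono hm le_rfl
  have : IsProbabilityMeasure (μ.map Y) := Measure.isProbabilityMeasure_map hY.aemeasurable
  have h1 : ∀ᵐ x ∂(μ.map X), ∀ᵐ y ∂(μ.map Y), P (x, y) := by
    have hms : MeasurableSet {x | ∀ᵐ y ∂(μ.map Y), P (x, y)} := by
      have h2 : {x | ∀ᵐ y ∂(μ.map Y), P (x, y)} =
          {x | (μ.map Y) (Prod.mk x ⁻¹' {q | P q}ᶜ) = 0} := by
        ext x; rw [mem_ofPred_eq, ae_iff]; rfl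
      rw [h2]
      exact measurable_measure_prodMk_left hP.compl (measurableSet_singleton 0)
    exact (ae_map_iff hX'.aemeasurable hms).2 hae
  have h2 := (Measure.ae_prod_iff_ae_ae (μ := μ.map X) hP).2 h1
  rw [← map_prodMk_of_indep hm hX hY h] at h2
  exact ae_of_ae_map (hX'.prodMk hY).aemeasurable h2

end Independence

/-! ### The randomized method -/

section RandomizedRun

variable {f g : E n → ℝ} {Gf Gg : E n → E n} {S Z : Set (E n)} {M : ℝ≥0} {δ ε p : ℝ}
  {Ω : Type*} [mΩ : MeasurableSpace Ω] {μ : Measure Ω}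
  {ℱ : Filtration ℕ mΩ} {U : ℕ → Ω → E n} {V : ℕ → Ω → ℝ} {r : ℕ → Ω → ℝ} {x₀ : E n}

theorem IsRandomSource.measurable (hs : IsRandomSource μ ℱ U V) (j : ℕ) :
    Measurable fun ω => (U j ω, V j ω) := (hs.adapted j).mono (ℱ.le _) le_rfl

theorem IsRandomSource.map_eq (hs : IsRandomSource μ ℱ U V) (j : ℕ) :
    μ.map (fun ω => (U j ω, V j ω)) = inputLaw n := hs.uniform j

theorem IsRandomSource.ae_mem_inputSet (hs : IsRandomSource μ ℱ U V) :
    ∀ᵐ ω ∂μ, ∀ j, (U j ω, V j ω) ∈ inputSet n := by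
  rw [ae_all_iff]
  intro j
  refine ae_of_ae_map (hs.measurable j).aemeasurable (p := fun y => y ∈ inputSet n) ?_
  rw [hs.map_eq j]
  exact ae_cond_mem measurableSet_inputSet

theorem measurable_randState (hf : Measurable f) (hg : Measurable g) (hGf : Measurable Gf)
    (hGg : Measurable Gg) (hs : IsRandomSource μ ℱ U V) (hr : ∀ j, Measurable[ℱ j] (r j)) (j : ℕ) :
    Measurable[ℱ j] fun ω => randState f g Gf Gg δ ε x₀ (fun j => r j ω) (fun j => U j ω)
      (fun j => V j ω) j := by
  induction j with
  | zero => exact measurable_const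
  | succ j ih =>
    have hle : ℱ j ≤ ℱ (j + 1) := ℱ.mono (Nat.le_succ j)
    have h1 := ih.mono hle le_rfl
    have h2 := (hr j).mono hle le_rfl
    have h3 := (measurable_step hf hg hGf hGg δ ε).comp (h1.prodMk (h2.prodMk (hs.adapted j)))
    exact h3

variable [IsProbabilityMeasure μ]

/-- Almost surely all states of the method are valid. -/
theorem IsRandomModel.ae_valid (hR : IsRandomModel f g Gf Gg S Z M δ ε p) (hx₀ : x₀ ∈ S)
    (hs : IsRandomSource μ ℱ U V) (hr : ∀ j, Measurable[ℱ j] (r j))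
    (hrad : ∀ᵐ ω ∂μ, ∀ j, (randState f g Gf Gg δ ε x₀ (fun j => r j ω) (fun j => U j ω)
      (fun j => V j ω) j).RadiusOK M (r j ω)) :
    ∀ᵐ ω ∂μ, ∀ j, (randState f g Gf Gg δ ε x₀ (fun j => r j ω) (fun j => U j ω)
      (fun j => V j ω) j).Valid f g Gf Gg δ ε S Z := by
  rw [ae_all_iff]
  intro j
  induction j with
  | zero => exact .of_forall fun _ => hx₀
  | succ j ih =>
    have hX := measurable_randState (δ := δ) (ε := ε) (x₀ := x₀) hR.lip_f.continuous.measurable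
      hR.lip_g.continuous.measurable hR.measurable_f hR.measurable_g hs hr j
    have hmeas : MeasurableSet {q : (RState n × ℝ) × E n × ℝ |
        q.1.1.enc.1 = 2 ∨ q.1.1.sample δ q.1.2 q.2.1 q.2.2 ∉ Z} := by
      have h1 : Measurable fun q : (RState n × ℝ) × E n × ℝ => q.1.1.enc.1 :=
        (measurable_fst.comp RState.measurable_enc).comp (measurable_fst.comp measurable_fst)
      have h2 : Measurable fun q : (RState n × ℝ) × E n × ℝ => q.1.1.sample δ q.1.2 q.2.1 q.2.2 := by
        have h3 : Measurable fun q : (RState n × ℝ) × E n × ℝ => (q.1.1, q.1.2, q.2) := by fun_prop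
        have h4 := (measurable_sample δ).comp h3
        exact h4
      exact (h1 (measurableSet_singleton 2)).union (h2 hR.measurableSet).compl
    have hgood := ae_comp_of_indep (ℱ.le j) (hX.prodMk (hr j)) (hs.measurable j) (hs.indep j) hmeas
      (by
        rw [hs.map_eq j]
        exact (ih.and hrad).mono fun ω hω => hR.ae_sample_notMem hω.1 (hω.2 j))
    filter_upwards [ih, hgood, hs.ae_mem_inputSet] with ω h1 h2 h3
    have h4 := hR.valid_step h1 (h3 j) h2
    exact h4

theorem IsRandomModel.lintegral_potential_le (hR : IsRandomModel f g Gf Gg S Z M δ ε p)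
    (hx₀ : x₀ ∈ S) (hs : IsRandomSource μ ℱ U V) (hr : ∀ j, Measurable[ℱ j] (r j))
    (hrad : ∀ᵐ ω ∂μ, ∀ j, (randState f g Gf Gg δ ε x₀ (fun j => r j ω) (fun j => U j ω)
      (fun j => V j ω) j).RadiusOK M (r j ω)) (T : ℕ) :
    ∫⁻ ω, ENNReal.ofReal ((randState f g Gf Gg δ ε x₀ (fun j => r j ω) (fun j => U j ω)
      (fun j => V j ω) T).potential f δ ε p) ∂μ ≤
      ENNReal.ofReal (contraction ε M) ^ T * ENNReal.ofReal (2 ^ callBound f δ ε p x₀) := by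
  have hfm := hR.lip_f.continuous.measurable
  have hgm := hR.lip_g.continuous.measurable
  induction T with
  | zero => simp [randState, RState.potential]
  | succ j ih =>
    have hX := measurable_randState (δ := δ) (ε := ε) (x₀ := x₀) hfm hgm hR.measurable_f
      hR.measurable_g hs hr j
    have hH : Measurable fun q : (RState n × ℝ) × E n × ℝ => ENNReal.ofReal
        ((RState.step f g Gf Gg δ ε q.1.2 q.2.1 q.2.2 q.1.1).potential f δ ε p) := by
      have h3 : Measurable fun q : (RState n × ℝ) × E n × ℝ => (q.1.1, q.1.2, q.2) := by fun_prop
      have h4 := ENNReal.measurable_ofReal.comp ((measurable_potential (δ := δ) (ε := ε) (p := p)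
        hfm).comp ((measurable_step hfm hgm hR.measurable_f hR.measurable_g δ ε).comp h3))
      exact h4
    have h1 := lintegral_comp_of_indep (ℱ.le j) (hX.prodMk (hr j)) (hs.measurable j) (hs.indep j) hH
    rw [hs.map_eq j] at h1
    have h2 := lintegral_mono_ae (μ := μ) (((hR.ae_valid hx₀ hs hr hrad).and hrad).mono fun ω hω =>
      hR.lintegral_potential_step_le (hω.1 j) (hω.2 j))
    rw [lintegral_const_mul' _ _ ENNReal.ofReal_ne_top] at h2
    calc _ = _ := h1
      _ ≤ _ := h2
      _ ≤ _ := mul_le_mul_right ih _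
      _ = _ := by rw [pow_succ', mul_assoc]

theorem IsRandomModel.one_le_potential (hR : IsRandomModel f g Gf Gg S Z M δ ε p) {s : RState n}
    (hs : s.Valid f g Gf Gg δ ε S Z) (hd : ¬ ∃ x, s = .done x) : 1 ≤ s.potential f δ ε p := by
  have hε := hR.pos_ε
  rcases s with x | ⟨x, ζ⟩ | x
  · exact one_le_pow₀ one_le_two
  · have h1 : ε ^ 2 / (2 * ‖ζ‖ ^ 2) ≤ 1 / 2 := by
      have h7 : ε ^ 2 ≤ ‖ζ‖ ^ 2 := by have := hs.2.2.1.le; gcongr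
      rw [div_le_div_iff₀ (by nlinarith) two_pos]
      linarith
    have h2 : (2 : ℝ) ^ 1 ≤ 2 ^ callBound f δ ε p x :=
      pow_le_pow_right₀ one_le_two (one_le_callBound x)
    rw [RState.potential]
    nlinarith
  · exact absurd ⟨x, rfl⟩ hd

/-- The tail bound: Markov's inequality for the potential. -/
theorem IsRandomModel.measure_not_done_le (hR : IsRandomModel f g Gf Gg S Z M δ ε p)
    (hx₀ : x₀ ∈ S) (hs : IsRandomSource μ ℱ U V) (hr : ∀ j, Measurable[ℱ j] (r j))
    (hrad : ∀ᵐ ω ∂μ, ∀ j, (randState f g Gf Gg δ ε x₀ (fun j => r j ω) (fun j => U j ω)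
      (fun j => V j ω) j).RadiusOK M (r j ω)) (T : ℕ) :
    μ {ω | ¬ ∃ x, randState f g Gf Gg δ ε x₀ (fun j => r j ω) (fun j => U j ω)
      (fun j => V j ω) T = .done x} ≤
      ENNReal.ofReal (contraction ε M) ^ T * ENNReal.ofReal (2 ^ callBound f δ ε p x₀) := by
  have hfm := hR.lip_f.continuous.measurable
  have hX := (measurable_randState (δ := δ) (ε := ε) (x₀ := x₀) hfm
    hR.lip_g.continuous.measurable hR.measurable_f hR.measurable_g hs hr T).mono (ℱ.le T) le_rfl
  have hm := ENNReal.measurable_ofReal.comp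
    ((measurable_potential (δ := δ) (ε := ε) (p := p) hfm).comp hX)
  have h1 := mul_meas_ge_le_lintegral₀ (μ := μ) hm.aemeasurable 1
  rw [one_mul] at h1
  refine (measure_mono_ae ?_).trans (h1.trans (hR.lintegral_potential_le hx₀ hs hr hrad T))
  filter_upwards [hR.ae_valid hx₀ hs hr hrad] with ω hω hd
  have := ENNReal.ofReal_le_ofReal (hR.one_le_potential (hω T) hd)
  rw [ENNReal.ofReal_one] at this
  exact this

theorem IsRandomModel.ae_exists_done (hR : IsRandomModel f g Gf Gg S Z M δ ε p)
    (hx₀ : x₀ ∈ S) (hs : IsRandomSource μ ℱ U V) (hr : ∀ j, Measurable[ℱ j] (r j))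
    (hrad : ∀ᵐ ω ∂μ, ∀ j, (randState f g Gf Gg δ ε x₀ (fun j => r j ω) (fun j => U j ω)
      (fun j => V j ω) j).RadiusOK M (r j ω)) :
    ∀ᵐ ω ∂μ, ∃ T x, randState f g Gf Gg δ ε x₀ (fun j => r j ω) (fun j => U j ω)
      (fun j => V j ω) T = .done x := by
  have hM : (0 : ℝ) < M := hR.pos_M
  have hε := hR.pos_ε
  have hc : ENNReal.ofReal (contraction ε M) < 1 := by
    rw [← ENNReal.ofReal_one, ENNReal.ofReal_lt_ofReal_iff one_pos, contraction,
      Real.exp_lt_one_iff, neg_lt_zero]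
    positivity
  have hlim : Tendsto (fun T : ℕ => ENNReal.ofReal (contraction ε M) ^ T *
      ENNReal.ofReal (2 ^ callBound f δ ε p x₀)) atTop (𝓝 0) := by
    have := ENNReal.Tendsto.mul_const (b := ENNReal.ofReal (2 ^ callBound f δ ε p x₀))
      (ENNReal.tendsto_pow_atTop_nhds_zero_of_lt_one hc) (.inr ENNReal.ofReal_ne_top)
    simpa using this
  rw [ae_iff]
  refine le_antisymm (ge_of_tendsto' hlim fun T => ?_) zero_le
  refine (measure_mono fun ω hω => ?_).trans (hR.measure_not_done_le hx₀ hs hr hrad T)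
  exact fun hx => hω ⟨T, hx⟩

/-- The number of steps in the statement is large enough to bring the tail bound below `τ`. -/
theorem contraction_pow_mul_le {A τ : ℝ} (hA : 1 ≤ A) (hτ : 0 < τ) (hτ1 : τ < 1) (hε : 0 < ε)
    {m : ℝ} (hm : 0 < m) :
    contraction ε m ^ (⌈A⌉₊ * ⌈64 * m ^ 2 / ε ^ 2⌉₊ * ⌈2 * Real.log (A / τ)⌉₊) * 2 ^ ⌈A⌉₊ ≤ τ := by
  have hAτ : 1 < A / τ := by rw [lt_div_iff₀ hτ]; linarith
  have hlog : 0 < Real.log (A / τ) := Real.log_pos hAτ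
  obtain ⟨N, hN⟩ : ∃ N, N = ⌈A⌉₊ := ⟨_, rfl⟩
  obtain ⟨B, hB⟩ : ∃ B, B = ⌈64 * m ^ 2 / ε ^ 2⌉₊ := ⟨_, rfl⟩
  obtain ⟨J, hJ⟩ : ∃ J, J = ⌈2 * Real.log (A / τ)⌉₊ := ⟨_, rfl⟩
  rw [← hN, ← hB, ← hJ]
  have hN1 : (1 : ℝ) ≤ N := by
    have : 1 ≤ N := by rw [hN]; exact Nat.one_le_ceil_iff.2 (by linarith)
    exact_mod_cast this
  have hJ1 : (1 : ℝ) ≤ J := by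
    have : 1 ≤ J := by rw [hJ]; exact Nat.one_le_ceil_iff.2 (by linarith)
    exact_mod_cast this
  have hJ2 : 2 * Real.log (A / τ) ≤ J := by rw [hJ]; exact Nat.le_ceil _
  have hB1 : 8 ≤ ε ^ 2 / (8 * m ^ 2) * B := by
    have h1 : 64 * m ^ 2 / ε ^ 2 ≤ B := by rw [hB]; exact Nat.le_ceil _
    calc (8 : ℝ) = ε ^ 2 / (8 * m ^ 2) * (64 * m ^ 2 / ε ^ 2) := by field_simp; norm_num
      _ ≤ _ := by gcongr
  -- The tail bound is `2 ^ N * exp (-(θ / 8) * (N * B * J))` with `θ = ε² / m²`, and `θ * B ≥ 64`.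
  have h2 : (2 : ℝ) ^ N ≤ Real.exp N := by
    have : (2 : ℝ) ≤ Real.exp 1 := by linarith [Real.add_one_le_exp (1 : ℝ)]
    calc (2 : ℝ) ^ N ≤ Real.exp 1 ^ N := by gcongr
      _ = Real.exp N := by rw [← Real.exp_nat_mul, mul_one]
  have h3 : Real.log τ = - Real.log (1 / τ) := by rw [one_div, Real.log_inv, neg_neg]
  have h4 : Real.log (1 / τ) ≤ Real.log (A / τ) := by
    apply Real.log_le_log (by positivity); gcongr
  calc contraction ε m ^ (N * B * J) * 2 ^ N
      ≤ contraction ε m ^ (N * B * J) * Real.exp N := by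
        gcongr
        exact pow_nonneg (Real.exp_pos _).le _
    _ = Real.exp (-((ε ^ 2 / (8 * m ^ 2) * B) * (N * J)) + N) := by
        rw [contraction, ← Real.exp_nat_mul, ← Real.exp_add]
        congr 1
        push_cast
        ring
    _ ≤ Real.exp (Real.log τ) := by
        refine Real.exp_le_exp.2 ?_
        have h5 : (N : ℝ) ≤ N * J := le_mul_of_one_le_right (by linarith) hJ1
        have h6 : (J : ℝ) ≤ N * J := le_mul_of_one_le_left (by linarith) hN1
        nlinarith
    _ = τ := Real.exp_log hτ

end RandomizedRun

/-! ### Localization of the randomized method -/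

section Localization

variable {f g f' g' : E n → ℝ} {Gf Gg : E n → E n} {S Z : Set (E n)} {M : ℝ≥0} {δ ε p : ℝ}

theorem IsLocalModel.congr {m : ℝ} (hL : IsLocalModel f g S m δ p) (hδ : 0 ≤ δ)
    (hf : ∀ x ∈ S, EqOn f f' (Metric.closedBall x δ))
    (hg : ∀ x ∈ S, EqOn g g' (Metric.closedBall x δ)) : IsLocalModel f' g' S m δ p where
  lip_f x hx y hy z hz := by
    rw [← hf x hx hy, ← hf x hx hz]; exact hL.lip_f x hx y hy z hz
  lip_g x hx y hy z hz := by
    rw [← hg x hx hy, ← hg x hx hz]; exact hL.lip_g x hx y hy z hz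
  nonpos x hx := by
    rw [← hg x hx (Metric.mem_closedBall_self hδ)]; exact hL.nonpos x hx
  mem x hx y hy h := hL.mem x hx y hy (by rwa [hg x hx hy])
  bound x hx := by
    rw [← hf x hx (Metric.mem_closedBall_self hδ)]; exact hL.bound x hx

theorem settle_congr (hδ : 0 ≤ δ) {x : E n} (hf : EqOn f f' (Metric.closedBall x δ))
    (hg : EqOn g g' (Metric.closedBall x δ)) (ζ : E n) :
    RState.settle f g δ ε x ζ = RState.settle f' g' δ ε x ζ := by
  have hx := Metric.mem_closedBall_self (x := x) hδ
  have hm := move_mem_closedBall hδ x ζ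
  have h1 : hFun f g x x = hFun f' g' x x := by simp only [hFun, hf hx, hg hx]
  have h2 : hFun f g x (move δ x ζ) = hFun f' g' x (move δ x ζ) := by
    simp only [hFun, hf hx, hf hm, hg hm]
  rw [RState.settle, RState.settle, h1, h2]

theorem gradOracle_congr (hδ : 0 ≤ δ) {x : E n} (hf : EqOn f f' (Metric.closedBall x δ))
    (hg : EqOn g g' (Metric.closedBall x δ)) {z : E n} (hz : z ∈ Metric.closedBall x δ) :
    gradOracle f g Gf Gg x z = gradOracle f' g' Gf Gg x z := by
  simp only [gradOracle, hf (Metric.mem_closedBall_self hδ), hf hz, hg hz]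

theorem IsRandomModel.settle_base_mem (hR : IsRandomModel f g Gf Gg S Z M δ ε p) {x : E n}
    (hx : x ∈ S) (ζ : E n) : (RState.settle f g δ ε x ζ).enc.2.1 ∈ S := by
  unfold RState.settle
  split_ifs with h1 h2
  · exact hx
  · exact hx
  · exact (hR.descent hx (not_le.1 h2) fun h => h1 ⟨not_le.1 h2, h⟩).1

/-- The method depends only on the values of `f` and `g` on the `δ`-balls around `S`. -/
theorem IsRandomModel.randState_congr (hR : IsRandomModel f' g' Gf Gg S Z M δ ε p)
    (hf : ∀ x ∈ S, EqOn f f' (Metric.closedBall x δ))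
    (hg : ∀ x ∈ S, EqOn g g' (Metric.closedBall x δ)) {x₀ : E n} (hx₀ : x₀ ∈ S) (r : ℕ → ℝ)
    {u : ℕ → E n} {v : ℕ → ℝ} (h : ∀ j, (u j, v j) ∈ inputSet n) (j : ℕ) :
    randState f g Gf Gg δ ε x₀ r u v j = randState f' g' Gf Gg δ ε x₀ r u v j ∧
      (randState f' g' Gf Gg δ ε x₀ r u v j).enc.2.1 ∈ S := by
  have hδ := hR.pos_δ.le
  induction j with
  | zero => exact ⟨rfl, hx₀⟩
  | succ j ih =>
    obtain ⟨h1, h2⟩ := ih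
    simp only [randState, h1]
    generalize randState f' g' Gf Gg δ ε x₀ r u v j = s at h2
    rcases s with x | ⟨x, ζ⟩ | x
    · have hz := sample_call_mem_closedBall (r := r j) hδ x (h j)
      simp only [RState.step]
      rw [RState.sample] at hz
      rw [settle_congr hδ (hf x h2) (hg x h2), gradOracle_congr hδ (hf x h2) (hg x h2) hz]
      exact ⟨rfl, hR.settle_base_mem h2 _⟩
    · have hz := sample_inner_mem_closedBall (r := r j) hδ x ζ (h j)
      simp only [RState.step]
      rw [RState.sample] at hz
      rw [settle_congr hδ (hf x h2) (hg x h2), gradOracle_congr hδ (hf x h2) (hg x h2) hz]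
      exact ⟨rfl, hR.settle_base_mem h2 _⟩
    · exact ⟨rfl, h2⟩

end Localization

theorem mem_clarke_of_hasGradientAt {h : E n → ℝ} {w z : E n} (hw : HasGradientAt h w z) :
    w ∈ clarke h z := by
  refine subset_convexHull _ _ ⟨fun _ => z, fun _ => hw.differentiableAt, tendsto_const_nhds, ?_⟩
  simp only [hw.gradient]
  exact tendsto_const_nhds

/-- Almost sure termination and the complexity bound of the randomized method. The functions are
replaced by global Lipschitz extensions of their restrictions to `N`, which makes all maps
involved measurable and changes the run of the method on a null set only. -/
theorem randomized_method {f g : E n → ℝ} {M : ℝ≥0} (hM : 0 < M) {Δ δ ε' σ p : ℝ}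
    (hp : IsGLB (f '' feasible g) p) {N : Set (E n)} (hN : N = Metric.thickening Δ (feasible g))
    (hfL : LipschitzOnWith M f N) (hgL : LipschitzOnWith M g N) {x₀ : E n} (hx₀ : g x₀ ≤ 0)
    (hδ : 0 < δ) (hδΔ : δ < Δ) (hε' : 0 < ε') (hσ : 0 < σ) {ε : ℝ}
    (hε : ε = σ * ε' / (ε' + σ + M))
    (hQ : ∀ x ∈ feasible g, GCQ clarke (fun _ : Unit => g) δ σ (2 * M * δ) x)
    {Gf Gg : E n → E n} (hGf : Measurable Gf) (hGg : Measurable Gg)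
    (hgf : ∀ᵐ z ∂(volume : Measure (E n)), z ∈ N → HasGradientAt f (Gf z) z)
    (hgg : ∀ᵐ z ∂(volume : Measure (E n)), z ∈ N → HasGradientAt g (Gg z) z)
    {Ω : Type*} [MeasurableSpace Ω] {μ : Measure Ω} [IsProbabilityMeasure μ]
    {ℱ : Filtration ℕ (inferInstance : MeasurableSpace Ω)}
    {U : ℕ → Ω → E n} {V : ℕ → Ω → ℝ} {r : ℕ → Ω → ℝ} {state : Ω → ℕ → RState n}
    (hst : ∀ ω, state ω = randState f g Gf Gg δ ε x₀
      (fun j => r j ω) (fun j => U j ω) (fun j => V j ω))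
    (hs : IsRandomSource μ ℱ U V) (hr : IsRadiusChoice μ ℱ M state r) :
    (∀ᵐ ω ∂μ, ∃ T x, state ω T = .done x ∧
      IsGKKT clarke f (fun _ : Unit => g) δ ε' (3 * M * δ * (ε' + σ + M) / σ) x) ∧
    ∀ τ : ℝ, 0 < τ → τ < 1 → ∀ T : ℕ,
      T = ⌈max 1 (4 * (f x₀ - p) / (δ * ε))⌉₊ * ⌈64 * (M : ℝ) ^ 2 / ε ^ 2⌉₊ *
        ⌈2 * Real.log (max 1 (4 * (f x₀ - p) / (δ * ε)) / τ)⌉₊ →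
      ENNReal.ofReal (1 - τ) ≤ μ {ω | ∃ x, state ω T = .done x ∧
        IsGKKT clarke f (fun _ : Unit => g) δ ε' (3 * M * δ * (ε' + σ + M) / σ) x} := by
  have hMr : (0 : ℝ) < M := hM
  have hεp : 0 < ε := by rw [hε]; positivity
  have hNo : IsOpen N := hN ▸ Metric.isOpen_thickening
  have hball : ∀ x ∈ feasible g, Metric.closedBall x δ ⊆ N := fun x hx =>
    hN ▸ closedBall_subset_thickening_of_mem hx hδΔ
  have hL : IsLocalModel f g (feasible g) M δ p :=
    isLocalModel_feasible hδΔ hp (hN ▸ hfL) (hN ▸ hgL)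
  obtain ⟨f', hf', hfe⟩ := hfL.extend_real
  obtain ⟨g', hg', hge⟩ := hgL.extend_real
  have hfe' : ∀ x ∈ feasible g, EqOn f f' (Metric.closedBall x δ) := fun x hx =>
    hfe.mono (hball x hx)
  have hge' : ∀ x ∈ feasible g, EqOn g g' (Metric.closedBall x δ) := fun x hx =>
    hge.mono (hball x hx)
  obtain ⟨Z, hZsub, hZm, hZ0⟩ := exists_measurable_superset_of_null (ae_iff.1 (hgf.and hgg))
  have hgood : ∀ z ∈ N, z ∉ Z → HasGradientAt f (Gf z) z ∧ HasGradientAt g (Gg z) z := by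
    intro z hz hzZ
    have := not_not.1 fun h => hzZ (hZsub h)
    exact ⟨this.1 hz, this.2 hz⟩
  have hR : IsRandomModel f' g' Gf Gg (feasible g) Z M δ ε p :=
    { local_model := hL.congr hδ.le hfe' hge'
      lip_f := hf'
      lip_g := hg'
      measurable_f := hGf
      measurable_g := hGg
      measurableSet := hZm
      null := hZ0
      grad := fun x hx z hz hzZ => by
        have hzN := hball x hx hz
        obtain ⟨h1, h2⟩ := hgood z hzN hzZ
        have hnhds := hNo.mem_nhds hzN
        exact ⟨h1.congr_of_eventuallyEq (hfe.eventuallyEq_of_mem hnhds).symm,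
          h2.congr_of_eventuallyEq (hge.eventuallyEq_of_mem hnhds).symm⟩
      pos_M := hM
      pos_δ := hδ
      pos_ε := hεp }
  -- The final states certify Goldstein KKT points of the original problem.
  have hcert : ∀ x, (RState.done x).Valid f' g' Gf Gg δ ε (feasible g) Z →
      IsGKKT clarke f (fun _ : Unit => g) δ ε' (3 * M * δ * (ε' + σ + M) / σ) x := by
    rintro x ⟨hx, ξ, hξ, hξε⟩
    refine isGKKT_of_mem_convexHull hL hMr.le hδ hε' hσ hx (hQ x hx) ?_ ?_ (hε ▸ hξε)
    · obtain ⟨z, hz, hzZ⟩ : ∃ z ∈ Metric.closedBall x δ, z ∉ Z := by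
        by_contra! hcon
        have h1 := measure_mono (μ := (volume : Measure (E n))) hcon
        rw [hZ0] at h1
        exact (Metric.measure_closedBall_pos volume x hδ).ne' (le_antisymm h1 zero_le)
      exact ⟨Gg z, subset_convexHull _ _ (mem_iUnion₂.2 ⟨z, hz,
        mem_clarke_of_hasGradientAt (hgood z (hball x hx hz) hzZ).2⟩)⟩
    · refine convexHull_mono ?_ hξ
      rintro w ⟨z, hz, hzZ, rfl⟩
      have hw := hR.norm_gradValues_le hx ⟨z, hz, hzZ, rfl⟩
      obtain ⟨h1, h2⟩ := hgood z (hball x hx hz) hzZ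
      rw [← gradOracle_congr hδ.le (hfe' x hx) (hge' x hx) hz] at hw ⊢
      unfold gradOracle at hw ⊢
      split_ifs at hw ⊢ with h
      · exact .inl ⟨z, hz, mem_clarke_of_hasGradientAt h1, hw⟩
      · exact .inr ⟨z, hz, mem_clarke_of_hasGradientAt h2, (not_le.1 h).le⟩
  have hstate : ∀ᵐ ω ∂μ, ∀ j, state ω j = randState f' g' Gf Gg δ ε x₀
      (fun j => r j ω) (fun j => U j ω) (fun j => V j ω) j := by
    filter_upwards [hs.ae_mem_inputSet] with ω hω j
    rw [hst ω]
    exact (hR.randState_congr hfe' hge' (show x₀ ∈ feasible g from hx₀) _ hω j).1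
  have hrad : ∀ᵐ ω ∂μ, ∀ j, (randState f' g' Gf Gg δ ε x₀ (fun j => r j ω) (fun j => U j ω)
      (fun j => V j ω) j).RadiusOK M (r j ω) := by
    filter_upwards [hstate, hr.range] with ω h1 h2 j x ζ h
    exact h2 j x ζ ((h1 j).trans h)
  have hvalid := hR.ae_valid (show x₀ ∈ feasible g from hx₀) hs hr.adapted hrad
  have hdone : ∀ᵐ ω ∂μ, ∀ T x, randState f' g' Gf Gg δ ε x₀
      (fun j => r j ω) (fun j => U j ω) (fun j => V j ω) T = .done x → state ω T = .done x ∧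
      IsGKKT clarke f (fun _ : Unit => g) δ ε' (3 * M * δ * (ε' + σ + M) / σ) x := by
    filter_upwards [hstate, hvalid] with ω h1 h2 T x h
    exact ⟨(h1 T).trans h, hcert x (h ▸ h2 T)⟩
  refine ⟨?_, ?_⟩
  · filter_upwards [hR.ae_exists_done (show x₀ ∈ feasible g from hx₀) hs hr.adapted hrad, hdone]
      with ω ⟨T, x, h⟩ h2
    exact ⟨T, x, h2 T x h⟩
  · intro τ hτ hτ1 T hT
    set G := {ω | ∃ x, state ω T = .done x ∧
      IsGKKT clarke f (fun _ : Unit => g) δ ε' (3 * M * δ * (ε' + σ + M) / σ) x}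
    have hfx : f' x₀ = f x₀ :=
      (hfe' x₀ hx₀ (Metric.mem_closedBall_self hδ.le)).symm
    have h1 : μ Gᶜ ≤ ENNReal.ofReal τ := by
      have hle : μ Gᶜ ≤ μ {ω | ¬ ∃ x, randState f' g' Gf Gg δ ε x₀ (fun j => r j ω)
          (fun j => U j ω) (fun j => V j ω) T = .done x} := by
        refine measure_mono_ae ?_
        filter_upwards [hdone] with ω h2 hω
        rintro ⟨x, hx⟩
        exact hω ⟨x, h2 T x hx⟩
      refine hle.trans ((hR.measure_not_done_le (show x₀ ∈ feasible g from hx₀) hs hr.adapted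
        hrad T).trans ?_)
      have hc : 0 ≤ contraction ε M := (Real.exp_pos _).le
      rw [← ENNReal.ofReal_pow hc, ← ENNReal.ofReal_mul (pow_nonneg hc _), callBound, hfx, hT]
      exact ENNReal.ofReal_le_ofReal
        (contraction_pow_mul_le (le_max_left _ _) hτ hτ1 hεp hMr)
    have h2 : (1 : ℝ≥0∞) ≤ μ G + μ Gᶜ := by
      rw [← measure_univ (μ := μ), ← union_compl_self G]
      exact measure_union_le _ _
    rw [ENNReal.ofReal_sub _ hτ.le, ENNReal.ofReal_one, tsub_le_iff_right]
    exact h2.trans (by gcongr)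

end Goldstein

theorem theorem2 {n m : ℕ} (hm : 0 < m)
    (f : E n → ℝ) (gs : Fin m → E n → ℝ) (g : E n → ℝ) (hg : g = maxConstraint gs)
    (M : ℝ≥0) (hM : 0 < M) (Δ δ ε σ pstar : ℝ)
    (hp : IsGLB (f '' feasible g) pstar)
    (N : Set (E n)) (hN : N = Metric.thickening Δ (feasible g))
    (hfL : LipschitzOnWith M f N) (hgL : ∀ i, LipschitzOnWith M (gs i) N)
    (x₀ : E n) (hx₀ : g x₀ ≤ 0)
    (hδ : 0 < δ) (hδΔ : δ < Δ) (hε : 0 < ε) (hσ : 0 < σ)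
    (εt : ℝ) (hεt : εt = σ * ε / (ε + σ + M))
    (η : ℝ) (hη : η = 3 * M * δ * (ε + σ + M) / σ) :
    -- Black-box subroutine, any notion of subdifferential.
    (∀ (D : Subdiff n), (∀ x ∈ feasible g, GCQ D (fun _ : Unit => g) δ σ (2 * M * δ) x) →
      ∀ (Gf Gg : E n → E n) (Gh : E n → E n → E n), IsOracle D f g N M Gf Gg Gh →
      ∀ C : ℝ, 0 < C → C < 1 →
      ∀ x ζ : ℕ → E n, IsRun f g Gh C δ εt x₀ x ζ →
        ∃ K, (∀ j < K, εt < ‖ζ j‖) ∧ ‖ζ K‖ ≤ εt ∧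
          IsGKKT D f (fun _ : Unit => g) δ ε η (x K)) ∧
    -- Randomized subroutine, gradient oracles almost everywhere, Clarke subdifferential.
    ((∀ x ∈ feasible g, GCQ clarke (fun _ : Unit => g) δ σ (2 * M * δ) x) →
      ∀ (Gf Gg : E n → E n), Measurable Gf → Measurable Gg →
      (∀ᵐ z ∂(volume : Measure (E n)), z ∈ N → HasGradientAt f (Gf z) z) →
      (∀ᵐ z ∂(volume : Measure (E n)), z ∈ N → HasGradientAt g (Gg z) z) →
      ∀ (Ω : Type*) [MeasurableSpace Ω] (μ : Measure Ω) [IsProbabilityMeasure μ]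
        (ℱ : Filtration ℕ (inferInstance : MeasurableSpace Ω))
        (U : ℕ → Ω → E n) (V : ℕ → Ω → ℝ) (r : ℕ → Ω → ℝ) (state : Ω → ℕ → RState n),
      (∀ ω, state ω = randState f g Gf Gg δ εt x₀
        (fun j => r j ω) (fun j => U j ω) (fun j => V j ω)) →
      IsRandomSource μ ℱ U V → IsRadiusChoice μ ℱ M state r →
        (∀ᵐ ω ∂μ, ∃ T x, state ω T = .done x ∧
          IsGKKT clarke f (fun _ : Unit => g) δ ε η x) ∧
        ∀ τ : ℝ, 0 < τ → τ < 1 → ∀ T : ℕ,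
          T = ⌈max 1 (4 * (f x₀ - pstar) / (δ * εt))⌉₊ * ⌈64 * (M : ℝ) ^ 2 / εt ^ 2⌉₊ *
            ⌈2 * Real.log (max 1 (4 * (f x₀ - pstar) / (δ * εt)) / τ)⌉₊ →
          ENNReal.ofReal (1 - τ) ≤ μ {ω | ∃ x, state ω T = .done x ∧
            IsGKKT clarke f (fun _ : Unit => g) δ ε η x}) ∧
    -- Deterministic subroutine, directional oracles, any subdifferential containing their values.
    (∀ (D : Subdiff n), (∀ x ∈ feasible g, GCQ D (fun _ : Unit => g) δ σ (2 * M * δ) x) →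
      ∀ (F G : E n → E n → E n), IsDirOracle f F → IsDirOracle g G →
      (∀ z ∈ N, ∀ v, F z v ∈ D f z ∧ G z v ∈ D g z ∧ ‖F z v‖ ≤ M ∧ ‖G z v‖ ≤ M) →
      nonconvexityModulus f δ ≠ ∞ → nonconvexityModulus g δ ≠ ∞ →
      ∀ dir : E n → E n,
        ∃ (T : ℕ) (x : E n), bisecState f g F G δ εt dir x₀ T = .done x ∧
          IsGKKT D f (fun _ : Unit => g) δ ε η x ∧
          ∑ j ∈ Finset.range T, (bisecState f g F G δ εt dir x₀ j).cost ≤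
            ⌈max 1 (3 * (f x₀ - pstar) / (δ * εt))⌉₊ * ⌈16 * (M : ℝ) ^ 2 / εt ^ 2⌉₊ *
              (1 + ⌊12 * ((nonconvexityModulus f δ).toReal +
                (nonconvexityModulus g δ).toReal) / εt⌋₊)) := by
  subst hg
  have hgL' := hN ▸ lipschitzOnWith_maxConstraint hm hgL
  have hMr : (0 : ℝ) < M := hM
  have hball : ∀ x ∈ feasible (maxConstraint gs), Metric.closedBall x δ ⊆ N := fun x hx =>
    hN ▸ closedBall_subset_thickening_of_mem hx hδΔ
  have hL : IsLocalModel f (maxConstraint gs) (feasible (maxConstraint gs)) M δ pstar :=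
    isLocalModel_feasible hδΔ hp (hN ▸ hfL) hgL'
  refine ⟨?_, ?_, ?_⟩
  · intro D hQ Gf Gg Gh hO C hC _ x ζ hr
    rw [hη]
    rw [hεt] at hr ⊢
    exact exists_isGKKT_of_isRun hL hball hMr.le hδ hε hσ hQ hO hC hx₀ hr
  · intro hQ Gf Gg hGf hGg hgf hgg Ω _ μ _ ℱ U V r state hst hs hr
    rw [hη]
    exact randomized_method hM hp hN hfL (lipschitzOnWith_maxConstraint hm hgL) hx₀ hδ hδΔ hε hσ
      hεt hQ hGf hGg hgf hgg hst hs hr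
  · intro D hQ F G hF hG hO hf hg dir
    rw [hη]
    exact exists_bisecState_eq_done hL hMr hδ hε hσ hεt hQ hF hG
      (fun x hx z hz v => hO z (hball x hx hz) v) hf hg hx₀
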